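/- Let $\mathcal O$ be a Dedekind domain of characteristic zero with fraction field $K$, let $\mathfrak p$ be a maximal ideal of $\mathcal O$ whose residue field $k=\mathcal O/\mathfrak p$ has characteristic $p>0$, and let $G$ be a finite group such that $K$ and $k$ are splitting fields for $G$ (a finite-dimensional algebra $A$ over a field $F$ is *split* if $\operatorname{End}_A(S)=F$ for every simple $A$-module $S$; $F$ is a splitting field for $G$ if $FG$ is split). For a field $F$ let $\mathcal R(FG)$ be the Grothendieck ring of the category of finite-dimensional $FG$-modules, with product induced by the tensor product; put $\mathcal R(G)=\mathcal R(KG)$ and $k\mathcal R(G)=k\otimes_{\mathbb Z}\mathcal R(G)$. For a conjugacy class $C$ of $G$, evaluation of virtual characters at $C$ takes values in $\mathcal O$; let $\overline{\mathrm{ev}}_C:k\mathcal R(G)\to k$ be the $k$-algebra homomorphism $c\otimes\chi\mapsto c\,\overline{\chi(C)}$, where the bar denotes reduction modulo $\mathfrak p$, and let $\overline{\mathcal D}_C$ be the one-dimensional $k\mathcal R(G)$-module on which $f$ acts as multiplication by $\overline{\mathrm{ev}}_C(f)$. Let $d_{\mathfrak p}:\mathcal R(KG)\to\mathcal R(kG)$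 be the decomposition map, which sends the class of a $KG$-module $V$ to the class of $L/\mathfrak pL$ for any $G$-stable $\mathcal O_{\mathfrak p}$-lattice $L$ in $V$, and let $d_{\mathfrak p}^k:k\mathcal R(G)\to k\otimes_{\mathbb Z}\mathcal R(kG)$ be its $k$-linear extension. A conjugacy class is *$p$-regular* if its elements have order prime to $p$. Then: (a) the modules $\overline{\mathcal D}_C$, for $C$ running over the $p$-regular conjugacy classes of $G$, form a family of representatives of the isomorphism classes of simple $k\mathcal R(G)$-modules: they are simple and pairwise non-isomorphic, and every simple $k\mathcal R(G)$-module is isomorphic to one of them; (b) the set of irreducible characters of $k\mathcal R(G)$ (the trace functions of its simple modules) is $\{\overline{\mathrm{ev}}_C : C \text{ a } p\text{-regular conjugacy class of } G\}$; (c) the Jacobson radical of $k\mathcal R(G)$ is the kernel of $d_{\mathfrak p}^k$; (d) the $k$-algebra $k\mathcal R(G)$ is split. -/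

import Mathlib

open scoped TensorProduct

namespace CharacterRing

universe u v w

section Grothendieck

variable (F : Type u) [Field F] (G : Type v) [Group G]

/-- Finite-dimensional representations of `G` over `F`, written in coordinates; every
finite-dimensional representation is isomorphic to one of these. -/
abbrev CoordRep := Σ n : ℕ, Representation F G (Fin n → F)

/-- The elements `[b] - [a] - [c]` attached to the short exact sequences `0 → a → b → c → 0`. -/
def exactRelations : Set (FreeAbelianGroup (CoordRep F G)) :=
  {x | ∃ (a b c : CoordRep F G) (f : a.2.IntertwiningMap b.2) (h : b.2.IntertwiningMap c.2),
    Function.Injective f ∧ Function.Exact f h ∧ Function.Surjective h ∧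
    x = FreeAbelianGroup.of b - FreeAbelianGroup.of a - FreeAbelianGroup.of c}

/-- The Grothendieck group of the category of finite-dimensional `FG`-modules: the free abelian
group on the modules, modulo the relations given by short exact sequences. Its ring structure,
induced by the tensor product over `F`, is defined below. -/
def Groth : Type (max u v) :=
  FreeAbelianGroup (CoordRep F G) ⧸ AddSubgroup.closure (exactRelations F G)

noncomputable instance : AddCommGroup (Groth F G) :=
  inferInstanceAs (AddCommGroup (_ ⧸ AddSubgroup.closure (exactRelations F G)))

variable {F G}

section Class

variable {V V₁ V₂ V₃ : Type*} [AddCommGroup V] [Module F V] [AddCommGroup V₁] [Module F V₁]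
  [AddCommGroup V₂] [Module F V₂] [AddCommGroup V₃] [Module F V₃]

/-- A finite-dimensional representation written in the coordinates of some basis. -/
noncomputable def coordRep [FiniteDimensional F V] (ρ : Representation F G V) : CoordRep F G :=
  ⟨Module.finrank F V,
    { toFun := fun g => (Module.finBasis F V).equivFun.conj (ρ g)
      map_one' := by simp [Module.End.one_eq_id]
      map_mul' := fun g h => by simp [Module.End.mul_eq_comp, LinearEquiv.conj_comp] }⟩

/-- The class `[V]` of a finite-dimensional representation `V` in the Grothendieck group. -/
noncomputable def cls [FiniteDimensional F V] (ρ : Representation F G V) : Groth F G :=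
  QuotientAddGroup.mk (FreeAbelianGroup.of (coordRep ρ))

/-- The coordinate form of a representation is isomorphic to it. -/
noncomputable def coordRepEquiv [FiniteDimensional F V] (ρ : Representation F G V) :
    ρ.Equiv (coordRep ρ).2 :=
  .mk (Module.finBasis F V).equivFun fun g => by
    refine LinearMap.ext fun x => ?_
    change (Module.finBasis F V).equivFun (ρ g x) = (Module.finBasis F V).equivFun
      (ρ g ((Module.finBasis F V).equivFun.symm ((Module.finBasis F V).equivFun x)))
    rw [LinearEquiv.symm_apply_apply]

theorem mk_exact {a b c : CoordRep F G} (f : a.2.IntertwiningMap b.2)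
    (h : b.2.IntertwiningMap c.2) (hf : Function.Injective f) (hfh : Function.Exact f h)
    (hh : Function.Surjective h) :
    (QuotientAddGroup.mk (FreeAbelianGroup.of b) : Groth F G) =
      QuotientAddGroup.mk (FreeAbelianGroup.of a) + QuotientAddGroup.mk (FreeAbelianGroup.of c) := by
  have : FreeAbelianGroup.of b - FreeAbelianGroup.of a - FreeAbelianGroup.of c ∈
      AddSubgroup.closure (exactRelations F G) :=
    AddSubgroup.subset_closure ⟨a, b, c, f, h, hf, hfh, hh, rfl⟩
  have h0 := (QuotientAddGroup.eq_zero_iff _).2 this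
  have h1 : (QuotientAddGroup.mk (FreeAbelianGroup.of b) : Groth F G) -
      QuotientAddGroup.mk (FreeAbelianGroup.of a) -
        QuotientAddGroup.mk (FreeAbelianGroup.of c) = 0 := h0
  rw [sub_sub, sub_eq_zero] at h1
  exact h1

theorem mk_iso {a b : CoordRep F G} (e : a.2.Equiv b.2) :
    (QuotientAddGroup.mk (FreeAbelianGroup.of b) : Groth F G) =
      QuotientAddGroup.mk (FreeAbelianGroup.of a) := by
  let z : CoordRep F G := ⟨0, 1⟩
  have hz : (QuotientAddGroup.mk (FreeAbelianGroup.of z) : Groth F G) = 0 := by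
    have := mk_exact (a := z) (b := z) (c := z) 0 0 (fun x y _ => Subsingleton.elim _ _)
      (fun x => by simp [Subsingleton.elim x 0]) (fun x => ⟨x, Subsingleton.elim _ _⟩)
    simpa using this
  have := mk_exact (a := a) (b := b) (c := z) e.toIntertwiningMap 0
    e.injective
    (fun x => ⟨fun _ => e.surjective x, fun _ => rfl⟩)
    (fun x => ⟨0, Subsingleton.elim _ _⟩)
  rw [this, hz, add_zero]

variable [FiniteDimensional F V₁] [FiniteDimensional F V₂] [FiniteDimensional F V₃]
  {ρ₁ : Representation F G V₁} {ρ₂ : Representation F G V₂} {ρ₃ : Representation F G V₃}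

theorem cls_coord (a : CoordRep F G) : cls a.2 = QuotientAddGroup.mk (FreeAbelianGroup.of a) :=
  mk_iso (coordRepEquiv a.2)

theorem cls_iso (e : ρ₁.Equiv ρ₂) : cls ρ₁ = cls ρ₂ :=
  mk_iso (((coordRepEquiv ρ₂).symm.trans e.symm).trans (coordRepEquiv ρ₁))

theorem cls_exact (f : V₁ →ₗ[F] V₂) (h : V₂ →ₗ[F] V₃)
    (hf' : ∀ g x, f (ρ₁ g x) = ρ₂ g (f x)) (hh' : ∀ g x, h (ρ₂ g x) = ρ₃ g (h x))
    (hf : Function.Injective f) (hfh : Function.Exact f h)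
    (hh : Function.Surjective h) : cls ρ₂ = cls ρ₁ + cls ρ₃ := by
  let f' : ρ₁.IntertwiningMap ρ₂ := ⟨f, fun g => LinearMap.ext (hf' g)⟩
  let h' : ρ₂.IntertwiningMap ρ₃ := ⟨h, fun g => LinearMap.ext (hh' g)⟩
  refine mk_exact
    (((coordRepEquiv ρ₂).toIntertwiningMap.comp f').comp (coordRepEquiv ρ₁).symm.toIntertwiningMap)
    (((coordRepEquiv ρ₃).toIntertwiningMap.comp h').comp (coordRepEquiv ρ₂).symm.toIntertwiningMap)
    ?_ ?_ ?_
  · intro x y hxy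
    apply (coordRepEquiv ρ₁).symm.injective
    apply hf
    apply (coordRepEquiv ρ₂).injective
    simpa [f'] using hxy
  · intro y
    obtain ⟨y, rfl⟩ := (coordRepEquiv ρ₂).surjective y
    have h1 : (coordRepEquiv ρ₃) (h y) = 0 ↔ h y = 0 :=
      (map_eq_zero_iff _ (coordRepEquiv ρ₃).injective)
    constructor
    · intro hy
      have hy : (coordRepEquiv ρ₃) (h y) = 0 := by simpa [h'] using hy
      obtain ⟨x, rfl⟩ := (hfh y).1 (h1.1 hy)
      exact ⟨coordRepEquiv ρ₁ x, by simp [f']⟩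
    · rintro ⟨x, hx⟩
      obtain ⟨x, rfl⟩ := (coordRepEquiv ρ₁).surjective x
      have hx : (coordRepEquiv ρ₂) (f x) = coordRepEquiv ρ₂ y := by simpa [f'] using hx
      have := (hfh y).2 ⟨x, (coordRepEquiv ρ₂).injective hx⟩
      simpa [h'] using h1.2 this
  · intro z
    obtain ⟨z, rfl⟩ := (coordRepEquiv ρ₃).surjective z
    obtain ⟨y, rfl⟩ := hh z
    exact ⟨coordRepEquiv ρ₂ y, by simp [h']⟩

end Class

namespace Groth

variable {H : Type*} [AddCommGroup H]

/-- An additive invariant of representations extends to the Grothendieck group. -/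
noncomputable def lift (φ : CoordRep F G → H)
    (hφ : ∀ (a b c : CoordRep F G) (f : a.2.IntertwiningMap b.2) (h : b.2.IntertwiningMap c.2),
      Function.Injective f → Function.Exact f h → Function.Surjective h → φ b = φ a + φ c) :
    Groth F G →+ H :=
  QuotientAddGroup.lift _ (FreeAbelianGroup.lift φ) <| by
    rw [AddSubgroup.closure_le]
    rintro _ ⟨a, b, c, f, h, h1, h2, h3, rfl⟩
    simp [hφ a b c f h h1 h2 h3]

theorem lift_mk (φ : CoordRep F G → H) (hφ) (a : CoordRep F G) :
    lift φ hφ (cls a.2) = φ a := by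
  rw [cls_coord]
  exact FreeAbelianGroup.lift_apply_of φ a

theorem lift_cls {V : Type*} [AddCommGroup V] [Module F V] [FiniteDimensional F V]
    (φ : CoordRep F G → H) (hφ) (ρ : Representation F G V) :
    lift φ hφ (cls ρ) = φ (coordRep ρ) :=
  FreeAbelianGroup.lift_apply_of φ _

theorem hom_ext {f g : Groth F G →+ H} (h : ∀ a : CoordRep F G, f (cls a.2) = g (cls a.2)) :
    f = g := by
  apply QuotientAddGroup.addMonoidHom_ext
  apply FreeAbelianGroup.lift_ext
  intro a
  have := h a
  rw [cls_coord] at this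
  exact this

theorem cls_exact_tprod_left {V : Type*} [AddCommGroup V] [Module F V] [FiniteDimensional F V]
    (ρ : Representation F G V)
    (a b c : CoordRep F G) (f : a.2.IntertwiningMap b.2) (h : b.2.IntertwiningMap c.2)
    (h1 : Function.Injective f) (h2 : Function.Exact f h) (h3 : Function.Surjective h) :
    cls (ρ.tprod b.2) = cls (ρ.tprod a.2) + cls (ρ.tprod c.2) := by
  refine cls_exact (f.toLinearMap.lTensor V) (h.toLinearMap.lTensor V) ?_ ?_ ?_ ?_ ?_
  · intro g x
    induction x with
    | zero => simp
    | add x y hx hy => simp only [map_add, hx, hy]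
    | tmul x y => simp [Representation.IntertwiningMap.isIntertwining]
  · intro g x
    induction x with
    | zero => simp
    | add x y hx hy => simp only [map_add, hx, hy]
    | tmul x y => simp [Representation.IntertwiningMap.isIntertwining]
  · exact Module.Flat.lTensor_preserves_injective_linearMap _ h1
  · exact lTensor_exact V h2 h3
  · exact LinearMap.lTensor_surjective V h3

theorem cls_tprod_comm {V W : Type*} [AddCommGroup V] [Module F V] [FiniteDimensional F V]
    [AddCommGroup W] [Module F W] [FiniteDimensional F W]
    (ρ : Representation F G V) (σ : Representation F G W) :
    cls (ρ.tprod σ) = cls (σ.tprod ρ) :=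
  cls_iso <| .mk (TensorProduct.comm F V W) fun g => by ext x y; simp

/-- Multiplication by the class of `V`. -/
noncomputable def mulCls {V : Type*} [AddCommGroup V] [Module F V] [FiniteDimensional F V]
    (ρ : Representation F G V) : Groth F G →+ Groth F G :=
  lift (fun b => cls (ρ.tprod b.2)) (cls_exact_tprod_left ρ)

theorem mulCls_cls {V W : Type*} [AddCommGroup V] [Module F V] [FiniteDimensional F V]
    [AddCommGroup W] [Module F W] [FiniteDimensional F W]
    (ρ : Representation F G V) (σ : Representation F G W) :
    mulCls ρ (cls σ) = cls (ρ.tprod σ) := by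
  rw [mulCls, lift_cls]
  refine cls_iso <| .mk (TensorProduct.congr (.refl F V) (coordRepEquiv σ).symm.toLinearEquiv)
    fun g => ?_
  ext x y
  have := (coordRepEquiv σ).symm.toIntertwiningMap.isIntertwining
  simp_all

/-- Multiplication on the Grothendieck group, induced by the tensor product. -/
noncomputable def mulHom : Groth F G →+ Groth F G →+ Groth F G :=
  lift (fun a => mulCls a.2) fun a b c f h h1 h2 h3 => by
    apply hom_ext
    intro d
    rw [AddMonoidHom.add_apply, mulCls_cls, mulCls_cls, mulCls_cls, cls_tprod_comm b.2,
      cls_tprod_comm a.2, cls_tprod_comm c.2]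
    exact cls_exact_tprod_left d.2 a b c f h h1 h2 h3

noncomputable instance : Mul (Groth F G) := ⟨fun x y => mulHom x y⟩

noncomputable instance : One (Groth F G) := ⟨cls (Representation.trivial F G F)⟩

theorem cls_mul_cls {V W : Type*} [AddCommGroup V] [Module F V] [FiniteDimensional F V]
    [AddCommGroup W] [Module F W] [FiniteDimensional F W]
    (ρ : Representation F G V) (σ : Representation F G W) :
    cls ρ * cls σ = cls (ρ.tprod σ) := by
  change mulHom (cls ρ) (cls σ) = _
  rw [mulHom, lift_cls, mulCls_cls, cls_tprod_comm, cls_tprod_comm ρ, ← mulCls_cls, ← mulCls_cls]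
  congr 1
  exact (cls_iso (coordRepEquiv ρ)).symm

theorem one_def : (1 : Groth F G) = cls (Representation.trivial F G F) := rfl

theorem induction {p : Groth F G → Prop} (h : ∀ a : CoordRep F G, p (cls a.2))
    (hneg : ∀ x, p x → p (-x)) (hadd : ∀ x y, p x → p y → p (x + y)) (x) : p x := by
  have h0 : p 0 := by
    have := hadd _ _ (h ⟨0, 1⟩) (hneg _ (h ⟨0, 1⟩))
    rwa [add_neg_cancel] at this
  induction x using QuotientAddGroup.induction_on with
  | H x =>
    induction x using FreeAbelianGroup.induction_on with
    | zero => exact h0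
    | of a => rw [← cls_coord]; exact h a
    | neg a _ => exact hneg _ (cls_coord a ▸ h a)
    | add x y hx hy => exact hadd _ _ hx hy

theorem mul_assoc' (x y z : Groth F G) : x * y * z = x * (y * z) := by
  have hadd : ∀ x y z : Groth F G, (x + y) * z = x * z + y * z := fun x y z => by
    change mulHom (x + y) z = _
    rw [map_add]; rfl
  have hneg : ∀ x z : Groth F G, (-x) * z = -(x * z) := fun x z => by
    change mulHom (-x) z = _
    rw [map_neg]; rfl
  have hadd' : ∀ x y z : Groth F G, z * (x + y) = z * x + z * y := fun x y z =>
    map_add (mulHom z) x y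
  have hneg' : ∀ x z : Groth F G, z * (-x) = -(z * x) := fun x z => map_neg (mulHom z) x
  induction x using induction with
  | hneg x hx => simp only [hneg, hx]
  | hadd x y hx hy => simp only [hadd, hx, hy]
  | h a =>
    induction y using induction with
    | hneg x hx => simp only [hneg, hneg', hx]
    | hadd x y hx hy => simp only [hadd, hadd', hx, hy]
    | h b =>
      induction z using induction with
      | hneg x hx => simp only [hneg', hx]
      | hadd x y hx hy => simp only [hadd', hx, hy]
      | h c =>
        simp only [cls_mul_cls]
        exact cls_iso <| .mk (TensorProduct.assoc F _ _ _) fun g => by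
          apply TensorProduct.ext_threefold
          intro x y z
          simp

noncomputable instance : CommRing (Groth F G) where
  __ := (inferInstance : AddCommGroup (Groth F G))
  mul := (· * ·)
  one := 1
  left_distrib x y z := map_add (mulHom x) y z
  right_distrib x y z := by
    change mulHom (x + y) z = _
    rw [map_add]; rfl
  zero_mul x := by
    change mulHom 0 x = 0
    rw [map_zero]; rfl
  mul_zero x := map_zero (mulHom x)
  mul_comm x y := by
    have : (mulHom : Groth F G →+ _) = mulHom.flip := by
      apply hom_ext
      intro a
      apply hom_ext
      intro b
      exact (cls_mul_cls _ _).trans ((cls_tprod_comm _ _).trans (cls_mul_cls _ _).symm)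
    exact DFunLike.congr_fun (DFunLike.congr_fun this x) y
  mul_assoc := mul_assoc'
  one_mul x := by
    have : mulHom (1 : Groth F G) = AddMonoidHom.id _ := by
      apply hom_ext
      intro a
      exact (cls_mul_cls _ _).trans (cls_iso <| .mk (TensorProduct.lid F _) fun g => by ext; simp)
    exact DFunLike.congr_fun this x
  mul_one x := by
    have : (mulHom : Groth F G →+ _).flip 1 = AddMonoidHom.id _ := by
      apply hom_ext
      intro a
      exact (cls_mul_cls _ _).trans (cls_iso <| .mk (TensorProduct.rid F _) fun g => by ext; simp)
    exact DFunLike.congr_fun this x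

end Groth
end Grothendieck

section Characters

variable {F : Type u} [Field F] {G : Type v} [Group G]

theorem trace_exact {V₁ V₂ V₃ : Type*} [AddCommGroup V₁] [Module F V₁] [FiniteDimensional F V₁]
    [AddCommGroup V₂] [Module F V₂] [FiniteDimensional F V₂]
    [AddCommGroup V₃] [Module F V₃] [FiniteDimensional F V₃]
    (f : V₁ →ₗ[F] V₂) (h : V₂ →ₗ[F] V₃) (hf : Function.Injective f) (hfh : Function.Exact f h)
    (hh : Function.Surjective h) (T₁ : Module.End F V₁) (T₂ : Module.End F V₂)
    (T₃ : Module.End F V₃) (h1 : f ∘ₗ T₁ = T₂ ∘ₗ f) (h2 : h ∘ₗ T₂ = T₃ ∘ₗ h) :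
    LinearMap.trace F V₂ T₂ = LinearMap.trace F V₁ T₁ + LinearMap.trace F V₃ T₃ := by
  obtain ⟨s, hs⟩ := h.exists_rightInverse_of_surjective (LinearMap.range_eq_top.2 hh)
  have hs' : ∀ x, h (s x) = x := fun x => LinearMap.congr_fun hs x
  let φ : V₂ →ₗ[F] LinearMap.range f := (LinearMap.id - s ∘ₗ h).codRestrict _ fun x => by
    refine (hfh _).1 ?_
    simp [hs']
  let r : V₂ →ₗ[F] V₁ := (LinearEquiv.ofInjective f hf).symm.toLinearMap ∘ₗ φ
  have hfr : f ∘ₗ r + s ∘ₗ h = LinearMap.id := by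
    ext x
    have : f ((LinearEquiv.ofInjective f hf).symm (φ x)) = φ x :=
      congrArg Subtype.val ((LinearEquiv.ofInjective f hf).apply_symm_apply (φ x))
    change f ((LinearEquiv.ofInjective f hf).symm (φ x)) + s (h x) = x
    rw [this]
    exact sub_add_cancel x (s (h x))
  have hrf : r ∘ₗ f = LinearMap.id := by
    ext x
    apply hf
    have := LinearMap.congr_fun hfr (f x)
    have h0 : h (f x) = 0 := (hfh _).2 ⟨x, rfl⟩
    simpa [h0] using this
  calc LinearMap.trace F V₂ T₂ = LinearMap.trace F V₂ (T₂ ∘ₗ (f ∘ₗ r + s ∘ₗ h)) := by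
        rw [hfr, LinearMap.comp_id]
    _ = LinearMap.trace F V₂ ((T₂ ∘ₗ f) ∘ₗ r) + LinearMap.trace F V₂ ((T₂ ∘ₗ s) ∘ₗ h) := by
        rw [LinearMap.comp_add, map_add, LinearMap.comp_assoc, LinearMap.comp_assoc]
    _ = LinearMap.trace F V₁ T₁ + LinearMap.trace F V₃ T₃ := by
        rw [← h1, LinearMap.comp_assoc, LinearMap.trace_comp_comm', LinearMap.comp_assoc, hrf,
          LinearMap.comp_id, LinearMap.trace_comp_comm' h (T₂ ∘ₗ s), ← LinearMap.comp_assoc, h2,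
          LinearMap.comp_assoc, hs, LinearMap.comp_id]

theorem character_exact (g : G) (a b c : CoordRep F G) (f : a.2.IntertwiningMap b.2)
    (h : b.2.IntertwiningMap c.2) (h1 : Function.Injective f) (h2 : Function.Exact f h)
    (h3 : Function.Surjective h) :
    b.2.character g = a.2.character g + c.2.character g :=
  trace_exact f.toLinearMap h.toLinearMap h1 h2 h3 _ _ _
    (LinearMap.ext fun x => f.isIntertwining _ _ g x)
    (LinearMap.ext fun x => h.isIntertwining _ _ g x)

/-- The value at `g` of (virtual) characters: the additive map with `[V] ↦ trace (g | V)`. -/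
noncomputable def characterAddHom (g : G) : Groth F G →+ F :=
  Groth.lift (fun a => a.2.character g) (character_exact g)

theorem characterAddHom_cls {V : Type*} [AddCommGroup V] [Module F V] [FiniteDimensional F V]
    (g : G) (ρ : Representation F G V) : characterAddHom g (cls ρ) = ρ.character g := by
  rw [characterAddHom, Groth.lift_cls]
  exact (congr_fun (Representation.char_iso (coordRepEquiv ρ)) g).symm

/-- The value at `g` of virtual characters, as a ring homomorphism. -/
noncomputable def characterHom (g : G) : Groth F G →+* F where
  __ := characterAddHom g
  map_one' := by
    change characterAddHom g 1 = 1
    rw [Groth.one_def, characterAddHom_cls]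
    simp [Representation.character]
  map_mul' x y := by
    change characterAddHom g (x * y) = characterAddHom g x * characterAddHom g y
    have hmul : ∀ x y : Groth F G, x * y = Groth.mulHom x y := fun _ _ => rfl
    induction x using Groth.induction with
    | hneg x hx => simp only [neg_mul, map_neg, hx]
    | hadd x y hx hy => simp only [add_mul, map_add, hx, hy]
    | h a =>
      induction y using Groth.induction with
      | hneg x hx => simp only [mul_neg, map_neg, hx]
      | hadd x y hx hy => simp only [mul_add, map_add, hx, hy]
      | h b =>
        rw [Groth.cls_mul_cls]
        simp only [characterAddHom_cls, Representation.char_tensor, Pi.mul_apply]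

theorem characterHom_cls {V : Type*} [AddCommGroup V] [Module F V] [FiniteDimensional F V]
    (g : G) (ρ : Representation F G V) : characterHom g (cls ρ) = ρ.character g :=
  characterAddHom_cls g ρ

theorem characterHom_ext {g h : G}
    (H : ∀ a : CoordRep F G, a.2.character g = a.2.character h) :
    (characterHom g : Groth F G →+* F) = characterHom h := by
  have : (characterAddHom g : Groth F G →+ F) = characterAddHom h := by
    apply Groth.hom_ext
    intro a
    simp only [characterAddHom_cls, H]
  exact RingHom.ext fun x => DFunLike.congr_fun this x

/-- The evaluation of virtual characters at a conjugacy class. -/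
noncomputable def evField (C : ConjClasses G) : Groth F G →+* F :=
  Quotient.liftOn C characterHom fun g h hgh => by
    obtain ⟨c, rfl⟩ := isConj_iff.1 hgh
    exact characterHom_ext fun a => (Representation.char_conj a.2 g c).symm

theorem isIntegral_trace_of_pow_eq_one {n m : ℕ} (hm : m ≠ 0) (M : Matrix (Fin n) (Fin n) F)
    (hM : M ^ m = 1) : IsIntegral ℤ M.trace := by
  let L := AlgebraicClosure F
  let N := M.map (algebraMap F L)
  have hN : N ^ m = 1 := by
    have := congrArg (fun A => (algebraMap F L).mapMatrix A) hM
    rw [map_pow, map_one] at this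
    exact this
  rw [← isIntegral_algebraMap_iff (algebraMap F L).injective]
  have h1 : algebraMap F L M.trace = N.trace := by
    simp [Matrix.trace, N]
  rw [h1, Matrix.trace_eq_sum_roots_charpoly]
  refine IsIntegral.multiset_sum fun μ hμ => ?_
  have hroot : N.charpoly.IsRoot μ := Polynomial.isRoot_of_mem_roots hμ
  rw [← Matrix.charpoly_toLin', ← Module.End.hasEigenvalue_iff_isRoot_charpoly] at hroot
  obtain ⟨v, hv⟩ := hroot.exists_hasEigenvector
  have h2 := hv.pow_apply m
  rw [← Matrix.toLin'_pow, hN, Matrix.toLin'_one, LinearMap.id_apply] at h2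
  have h3 : (μ ^ m - 1) • v = 0 := by rw [sub_smul, one_smul, ← h2, sub_self]
  have h4 : μ ^ m = 1 := sub_eq_zero.1 ((smul_eq_zero.1 h3).resolve_right hv.2)
  exact IsIntegral.of_pow (Nat.pos_of_ne_zero hm) (h4 ▸ isIntegral_one)

variable (O : Type w) [CommRing O] [IsIntegrallyClosed O] [Algebra O F]
  [IsFractionRing O F] [Finite G]

theorem evField_mem_range (C : ConjClasses G) (x : Groth F G) :
    evField C x ∈ (algebraMap O F).range := by
  induction C using Quotient.inductionOn with
  | h g =>
  change characterHom g x ∈ _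
  induction x using Groth.induction with
  | hneg x hx => rw [map_neg]; exact neg_mem hx
  | hadd x y hx hy => rw [map_add]; exact add_mem hx hy
  | h a =>
    rw [characterHom_cls]
    have h1 : IsIntegral ℤ (a.2.character g) := by
      rw [Representation.character, LinearMap.trace_eq_matrix_trace F (Pi.basisFun F (Fin a.1))]
      refine isIntegral_trace_of_pow_eq_one (Nat.card_pos (α := G)).ne' _ ?_
      rw [LinearMap.toMatrix_pow, ← map_pow, pow_card_eq_one', map_one]
      exact LinearMap.toMatrix_one _
    exact IsIntegrallyClosed.isIntegral_iff.1 h1.tower_top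

/-- The evaluation at a conjugacy class takes values in `O`. -/
noncomputable def ev (C : ConjClasses G) : Groth F G →+* O :=
  ((RingEquiv.ofBijective (algebraMap O F).rangeRestrict
    ⟨fun _ _ h => IsFractionRing.injective O F (congrArg Subtype.val h),
      (algebraMap O F).rangeRestrict_surjective⟩).symm : (algebraMap O F).range →+* O).comp
    ((evField C).codRestrict (algebraMap O F).range (evField_mem_range O C))

theorem algebraMap_ev (C : ConjClasses G) (x : Groth F G) :
    algebraMap O F (ev O C x) = evField C x := by
  have := (RingEquiv.ofBijective (algebraMap O F).rangeRestrict
    ⟨fun _ _ h => IsFractionRing.injective O F (congrArg Subtype.val h),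
      (algebraMap O F).rangeRestrict_surjective⟩).apply_symm_apply
        ⟨_, evField_mem_range O C x⟩
  exact congrArg Subtype.val this

/-- The algebra `kR(G) = k ⊗ R(G)` obtained from the Grothendieck ring of `FG` by extending
scalars from `ℤ` to a field `k`. -/
def ScalarGroth (k : Type*) [Field k] (F : Type u) [Field F] (G : Type v) [Group G] : Type _ :=
  k ⊗[ℤ] Groth F G

section ScalarGroth

variable (k : Type*) [Field k]

noncomputable instance : CommRing (ScalarGroth k F G) :=
  inferInstanceAs (CommRing (k ⊗[ℤ] Groth F G))

noncomputable instance : Algebra k (ScalarGroth k F G) :=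
  inferInstanceAs (Algebra k (k ⊗[ℤ] Groth F G))

variable (F) in
/-- The reduction `kR(G) → k` of the evaluation at a conjugacy class, for an `O`-algebra `k`:
the `k`-algebra homomorphism induced by `R(G) → O → k`. -/
noncomputable def evBar [Algebra O k] (C : ConjClasses G) : ScalarGroth k F G →ₐ[k] k :=
  Algebra.TensorProduct.lift (AlgHom.id k k) ((algebraMap O k).comp (ev O C)).toIntAlgHom
    fun _ _ => Commute.all _ _

theorem evBar_tmul [Algebra O k] (C : ConjClasses G) (c : k) (x : Groth F G) :
    evBar F O k C (c ⊗ₜ[ℤ] x : k ⊗[ℤ] Groth F G) = c * algebraMap O k (ev O C x) :=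
  Algebra.TensorProduct.lift_tmul _ _ _ _ _

/-- The `k`-linear extension `kR(FG) → kR(F'G)` of an additive map `R(FG) → R(F'G)`. -/
noncomputable def scalarMap {F' : Type*} [Field F'] (d : Groth F G →+ Groth F' G) :
    ScalarGroth k F G →ₗ[k] ScalarGroth k F' G :=
  LinearMap.baseChange k d.toIntLinearMap

end ScalarGroth

end Characters

section Decomposition

open IsLocalRing

section FourTerm

variable {F : Type u} [Field F] {G : Type v} [Group G]

/-- If `f : V → W` and `h : W → V` satisfy `ker h = im f` and `ker f = im h`, then `[V] = [W]`. -/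
theorem cls_eq_of_exact_exact {V W : Type*} [AddCommGroup V] [Module F V] [FiniteDimensional F V]
    [AddCommGroup W] [Module F W] [FiniteDimensional F W]
    {ρ : Representation F G V} {σ : Representation F G W} (f : V →ₗ[F] W) (h : W →ₗ[F] V)
    (hf : ∀ g x, f (ρ g x) = σ g (f x)) (hh : ∀ g x, h (σ g x) = ρ g (h x))
    (hfh : Function.Exact f h) (hhf : Function.Exact h f) : cls ρ = cls σ := by
  let ρ' := ρ.subrepresentation (LinearMap.ker f) fun g x hx => by
    change f (ρ g x) = 0
    rw [hf, show f x = 0 from hx, map_zero]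
  let σ' := σ.subrepresentation (LinearMap.ker h) fun g x hx => by
    change h (σ g x) = 0
    rw [hh, show h x = 0 from hx, map_zero]
  have e1 : cls ρ = cls ρ' + cls σ' := by
    refine cls_exact (LinearMap.ker f).subtype
      (f.codRestrict (LinearMap.ker h) fun x => (hfh _).2 ⟨x, rfl⟩) (fun g x => rfl)
      (fun g x => Subtype.ext (hf g x)) (Submodule.injective_subtype _) ?_ ?_
    · intro x
      rw [Submodule.coe_subtype, Subtype.range_coe]
      exact Subtype.ext_iff
    · rintro ⟨y, hy⟩
      obtain ⟨x, rfl⟩ := (hfh y).1 hy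
      exact ⟨x, rfl⟩
  have e2 : cls σ = cls σ' + cls ρ' := by
    refine cls_exact (LinearMap.ker h).subtype
      (h.codRestrict (LinearMap.ker f) fun x => (hhf _).2 ⟨x, rfl⟩) (fun g x => rfl)
      (fun g x => Subtype.ext (hh g x)) (Submodule.injective_subtype _) ?_ ?_
    · intro x
      rw [Submodule.coe_subtype, Subtype.range_coe]
      exact Subtype.ext_iff
    · rintro ⟨y, hy⟩
      obtain ⟨x, rfl⟩ := (hhf y).1 hy
      exact ⟨x, rfl⟩
  rw [e1, e2, add_comm]

end FourTerm

variable {A : Type u} [CommRing A] [IsLocalRing A] {G : Type v} [Group G]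

section Residual

variable {L L' L'' : Type*} [AddCommGroup L] [Module A L] [AddCommGroup L'] [Module A L']
  [AddCommGroup L''] [Module A L'']

/-- The reduction `k ⊗ L = L / 𝔪L` of an `AG`-module `L` modulo the maximal ideal of `A`. -/
noncomputable def residual (σ : Representation A G L) :
    Representation (ResidueField A) G (ResidueField A ⊗[A] L) where
  toFun g := (σ g).baseChange (ResidueField A)
  map_one' := by rw [map_one]; exact LinearMap.baseChange_id
  map_mul' g h := by rw [map_mul]; exact LinearMap.baseChange_comp _ _

theorem exists_one_tmul (z : ResidueField A ⊗[A] L) : ∃ x : L, z = 1 ⊗ₜ x := by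
  induction z with
  | zero => exact ⟨0, (TensorProduct.tmul_zero _ _).symm⟩
  | add x y hx hy =>
    obtain ⟨a, rfl⟩ := hx
    obtain ⟨b, rfl⟩ := hy
    exact ⟨a + b, (TensorProduct.tmul_add _ _ _).symm⟩
  | tmul c x =>
    obtain ⟨a, rfl⟩ := residue_surjective c
    refine ⟨a • x, ?_⟩
    rw [← TensorProduct.smul_tmul]
    congr 1
    exact (Algebra.algebraMap_eq_smul_one a)

theorem one_tmul_eq_zero {π : A} (hπ : maximalIdeal A = Ideal.span {π}) {x : L} :
    ((1 : ResidueField A) ⊗ₜ[A] x = 0) ↔ ∃ y, π • y = x := by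
  have h2 : TensorProduct.quotTensorEquivQuotSMul L (maximalIdeal A)
      ((1 : A ⧸ maximalIdeal A) ⊗ₜ[A] x) = Submodule.Quotient.mk x :=
    TensorProduct.quotTensorEquivQuotSMul_mk_one_tmul (maximalIdeal A) x
  have h3 : x ∈ maximalIdeal A • (⊤ : Submodule A L) ↔ ∃ y, π • y = x := by
    rw [hπ, Submodule.ideal_span_singleton_smul, Submodule.mem_smul_pointwise_iff_exists]
    exact ⟨fun ⟨y, _, hy⟩ => ⟨y, hy⟩, fun ⟨y, hy⟩ => ⟨y, trivial, hy⟩⟩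
  have h := (TensorProduct.quotTensorEquivQuotSMul L (maximalIdeal A)).map_eq_zero_iff
    (x := (1 : A ⧸ maximalIdeal A) ⊗ₜ[A] x)
  rw [h2, Submodule.Quotient.mk_eq_zero, h3] at h
  exact h.symm

theorem residual_equivariant {σ : Representation A G L} {σ' : Representation A G L'}
    (f : L →ₗ[A] L') (hf : ∀ g x, f (σ g x) = σ' g (f x)) (g : G)
    (z : ResidueField A ⊗[A] L) :
    f.baseChange (ResidueField A) (residual σ g z) =
      residual σ' g (f.baseChange (ResidueField A) z) := by
  obtain ⟨x, rfl⟩ := exists_one_tmul z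
  simp [residual, hf]

variable [Module.Finite A L] [Module.Finite A L'] [Module.Finite A L'']
  {σ : Representation A G L} {σ' : Representation A G L'} {σ'' : Representation A G L''}
  {π : A}

theorem cls_residual_exact (hπ : maximalIdeal A = Ideal.span {π})
    (f : L →ₗ[A] L') (h : L' →ₗ[A] L'') (hf : ∀ g x, f (σ g x) = σ' g (f x))
    (hh : ∀ g x, h (σ' g x) = σ'' g (h x)) (hfh : Function.Exact f h)
    (hsurj : Function.Surjective h) (hinj : ∀ x y, f x = π • y → ∃ z, π • z = x) :
    cls (residual σ') = cls (residual σ) + cls (residual σ'') := by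
  refine cls_exact (f.baseChange (ResidueField A)) (h.baseChange (ResidueField A))
    (residual_equivariant f hf) (residual_equivariant h hh) ?_
    (lTensor_exact (ResidueField A) hfh hsurj) (LinearMap.lTensor_surjective _ hsurj)
  rw [injective_iff_map_eq_zero]
  intro z hz
  obtain ⟨x, rfl⟩ := exists_one_tmul z
  rw [LinearMap.baseChange_tmul, one_tmul_eq_zero hπ] at hz
  obtain ⟨y, hy⟩ := hz
  exact (one_tmul_eq_zero hπ).2 (hinj x y hy.symm)

theorem cls_residual_step (hπ : maximalIdeal A = Ideal.span {π})
    (i : L →ₗ[A] L') (m : L' →ₗ[A] L) (hi : ∀ g x, i (σ g x) = σ' g (i x))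
    (hm : ∀ g x, m (σ' g x) = σ g (m x)) (him : ∀ x, i (m x) = π • x) (hmi : ∀ x, m (i x) = π • x)
    (hi' : Function.Injective i) (hm' : Function.Injective m) :
    cls (residual σ) = cls (residual σ') := by
  refine cls_eq_of_exact_exact (i.baseChange (ResidueField A)) (m.baseChange (ResidueField A))
    (residual_equivariant i hi) (residual_equivariant m hm) ?_ ?_
  · intro z
    obtain ⟨x, rfl⟩ := exists_one_tmul z
    constructor
    · intro hz
      rw [LinearMap.baseChange_tmul, one_tmul_eq_zero hπ] at hz
      obtain ⟨y, hy⟩ := hz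
      refine ⟨1 ⊗ₜ y, ?_⟩
      rw [LinearMap.baseChange_tmul]
      congr 1
      exact hm' (by rw [hmi, hy])
    · rintro ⟨w, hw⟩
      obtain ⟨y, rfl⟩ := exists_one_tmul w
      rw [← hw, LinearMap.baseChange_tmul, LinearMap.baseChange_tmul, hmi]
      exact (one_tmul_eq_zero hπ).2 ⟨y, rfl⟩
  · intro z
    obtain ⟨x, rfl⟩ := exists_one_tmul z
    constructor
    · intro hz
      rw [LinearMap.baseChange_tmul, one_tmul_eq_zero hπ] at hz
      obtain ⟨y, hy⟩ := hz
      refine ⟨1 ⊗ₜ y, ?_⟩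
      rw [LinearMap.baseChange_tmul]
      congr 1
      exact hi' (by rw [him, hy])
    · rintro ⟨w, hw⟩
      obtain ⟨y, rfl⟩ := exists_one_tmul w
      rw [← hw, LinearMap.baseChange_tmul, LinearMap.baseChange_tmul, him]
      exact (one_tmul_eq_zero hπ).2 ⟨y, rfl⟩

end Residual

variable {K : Type w} [Field K] [Algebra A K]

section Lattice

variable {V V' V'' : Type*} [AddCommGroup V] [Module K V] [Module A V] [IsScalarTower A K V]
  [AddCommGroup V'] [Module K V'] [Module A V'] [IsScalarTower A K V']
  [AddCommGroup V''] [Module K V''] [Module A V''] [IsScalarTower A K V'']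

/-- `L` is a `G`-stable `A`-lattice in the `KG`-module `V`: a finitely generated `A`-submodule that
spans `V` over `K` and is stable under `G`. -/
structure IsLattice (ρ : Representation K G V) (L : Submodule A V) : Prop where
  fg : L.FG
  span_eq_top : Submodule.span K (L : Set V) = ⊤
  stable : ∀ (g : G), ∀ x ∈ L, ρ g x ∈ L

/-- The action of `G` on a lattice. -/
noncomputable def IsLattice.rep {ρ : Representation K G V} {L : Submodule A V}
    (hL : IsLattice ρ L) : Representation A G L where
  toFun g := ((ρ g).restrictScalars A).restrict (hL.stable g)
  map_one' := LinearMap.ext fun x => Subtype.ext <| by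
    change ρ 1 (x : V) = x
    rw [map_one]; rfl
  map_mul' g h := LinearMap.ext fun x => Subtype.ext <| by
    change ρ (g * h) (x : V) = ρ g (ρ h x)
    rw [map_mul]; rfl

/-- The class in the Grothendieck group over the residue field of the reduction of a lattice. -/
noncomputable def IsLattice.red {ρ : Representation K G V} {L : Submodule A V}
    (hL : IsLattice ρ L) : Groth (ResidueField A) G :=
  have := Module.Finite.iff_fg.2 hL.fg
  cls (residual hL.rep)

theorem exists_smul_mem [IsDomain A] [IsFractionRing A K] {L : Submodule A V}
    (hL : Submodule.span K (L : Set V) = ⊤) (x : V) : ∃ a : A, a ≠ 0 ∧ a • x ∈ L := by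
  have hx : x ∈ Submodule.span K (L : Set V) := hL ▸ Submodule.mem_top
  induction hx using Submodule.span_induction with
  | mem x hx => exact ⟨1, one_ne_zero, by rwa [one_smul]⟩
  | zero => exact ⟨1, one_ne_zero, by simp⟩
  | add x y _ _ hx hy =>
    obtain ⟨a, ha, hax⟩ := hx
    obtain ⟨b, hb, hby⟩ := hy
    refine ⟨a * b, mul_ne_zero ha hb, ?_⟩
    rw [smul_add]
    refine add_mem ?_ ?_
    · rw [mul_comm, mul_smul]; exact L.smul_mem b hax
    · rw [mul_smul]; exact L.smul_mem a hby
  | smul c x _ hx =>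
    obtain ⟨a, ha, hax⟩ := hx
    obtain ⟨n, d, hd, rfl⟩ := IsFractionRing.div_surjective (A := A) c
    have hd0 := nonZeroDivisors.ne_zero hd
    refine ⟨d * a, mul_ne_zero hd0 ha, ?_⟩
    have hd1 : algebraMap A K d ≠ 0 := by
      simpa using (IsFractionRing.injective A K).ne hd0
    have : (d * a) • (algebraMap A K n / algebraMap A K d) • x = n • a • x := by
      rw [← algebraMap_smul K (d * a), ← algebraMap_smul K n, ← algebraMap_smul K a, smul_smul,
        smul_smul, map_mul]
      congr 1
      field_simp
    rw [this]
    exact L.smul_mem n hax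

theorem exists_smul_le [IsDomain A] [IsFractionRing A K] {L M : Submodule A V}
    (hL : Submodule.span K (L : Set V) = ⊤) (hM : M.FG) :
    ∃ a : A, a ≠ 0 ∧ ∀ x ∈ M, a • x ∈ L := by
  induction M, hM using Submodule.fg_induction with
  | singleton x =>
    obtain ⟨a, ha, hax⟩ := exists_smul_mem hL x
    refine ⟨a, ha, fun y hy => ?_⟩
    obtain ⟨b, rfl⟩ := Submodule.mem_span_singleton.1 hy
    rw [smul_comm]
    exact L.smul_mem b hax
  | sup M₁ M₂ _ _ h1 h2 =>
    obtain ⟨a, ha, h1⟩ := h1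
    obtain ⟨b, hb, h2⟩ := h2
    refine ⟨a * b, mul_ne_zero ha hb, fun x hx => ?_⟩
    obtain ⟨y, hy, z, hz, rfl⟩ := Submodule.mem_sup.1 hx
    rw [smul_add]
    refine add_mem ?_ ?_
    · rw [mul_comm, mul_smul]; exact L.smul_mem b (h1 y hy)
    · rw [mul_smul]; exact L.smul_mem a (h2 z hz)

variable {ρ : Representation K G V} {ρ' : Representation K G V'} {ρ'' : Representation K G V''}

/-- Every representation of a finite group contains a lattice. -/
theorem exists_isLattice (A : Type u) [CommRing A] [IsLocalRing A] [Algebra A K] [Module A V]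
    [IsScalarTower A K V] [Finite G] [FiniteDimensional K V] (ρ : Representation K G V) :
    ∃ L : Submodule A V, IsLattice ρ L := by
  let b := Module.finBasis K V
  let S : Set V := Set.range fun x : G × Fin (Module.finrank K V) => ρ x.1 (b x.2)
  refine ⟨Submodule.span A S, Submodule.fg_span (Set.finite_range _), ?_, ?_⟩
  · rw [eq_top_iff, ← b.span_eq, Submodule.span_le]
    rintro _ ⟨i, rfl⟩
    exact Submodule.subset_span (Submodule.subset_span ⟨(1, i), by simp⟩)
  · intro g x hx
    induction hx using Submodule.span_induction with
    | mem x hx =>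
      obtain ⟨⟨h, i⟩, rfl⟩ := hx
      exact Submodule.subset_span ⟨(g * h, i), by simp⟩
    | zero => simp
    | add x y _ _ hx hy => rw [map_add]; exact add_mem hx hy
    | smul a x _ hx =>
      rw [← algebraMap_smul K a x, map_smul, algebraMap_smul]
      exact Submodule.smul_mem _ a hx

variable [IsDomain A] [IsPrincipalIdealRing A] [IsFractionRing A K]

theorem red_eq_of_step {π : A} (hπ : maximalIdeal A = Ideal.span {π}) (hπ0 : π ≠ 0)
    {N M : Submodule A V} (hN : IsLattice ρ N) (hM : IsLattice ρ M) (hNM : N ≤ M)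
    (hπM : ∀ x ∈ M, π • x ∈ N) : hN.red = hM.red := by
  have := Module.Finite.iff_fg.2 hN.fg
  have := Module.Finite.iff_fg.2 hM.fg
  refine cls_residual_step hπ (Submodule.inclusion hNM)
    ((LinearMap.lsmul A V π).restrict hπM) ?_ ?_ ?_ ?_ (Submodule.inclusion_injective _) ?_
  · intro g x; rfl
  · intro g x
    refine Subtype.ext ?_
    change π • ρ g x = ρ g (π • (x : V))
    rw [← algebraMap_smul K π (x : V), map_smul, algebraMap_smul]
  · intro x; rfl
  · intro x; rfl
  · intro x y hxy
    have h1 : π • (x : V) = π • (y : V) := congrArg Subtype.val hxy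
    rw [← algebraMap_smul K π (x : V), ← algebraMap_smul K π (y : V)] at h1
    have hd1 : algebraMap A K π ≠ 0 := by
      simpa using (IsFractionRing.injective A K).ne hπ0
    exact Subtype.ext (smul_right_injective V hd1 h1)

theorem red_eq_of_pow {π : A} (hπ : maximalIdeal A = Ideal.span {π}) (hπ0 : π ≠ 0) (n : ℕ)
    {N M : Submodule A V} (hN : IsLattice ρ N) (hM : IsLattice ρ M) (hNM : N ≤ M)
    (hπM : ∀ x ∈ M, π ^ n • x ∈ N) : hN.red = hM.red := by
  induction n generalizing N M with
  | zero =>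
    have : N = M := le_antisymm hNM fun x hx => by simpa using hπM x hx
    subst this
    rfl
  | succ n ih =>
    let P : Submodule A V := N ⊔ M.map (LinearMap.lsmul A V π)
    have hPM : P ≤ M := by
      refine sup_le hNM ?_
      rintro _ ⟨x, hx, rfl⟩
      exact M.smul_mem π hx
    have hP : IsLattice ρ P := by
      refine ⟨hN.fg.sup (hM.fg.map _), ?_, ?_⟩
      · rw [eq_top_iff, ← hN.span_eq_top]
        exact Submodule.span_mono (fun x hx => Submodule.mem_sup_left hx)
      · intro g x hx
        obtain ⟨y, hy, _, ⟨z, hz, rfl⟩, rfl⟩ := Submodule.mem_sup.1 hx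
        rw [map_add]
        refine Submodule.add_mem_sup (hN.stable g y hy) ⟨ρ g z, hM.stable g z hz, ?_⟩
        change π • ρ g z = ρ g (π • z)
        rw [← algebraMap_smul K π z, map_smul, algebraMap_smul]
    rw [← red_eq_of_step hπ hπ0 hP hM hPM fun x hx => Submodule.mem_sup_right ⟨x, hx, rfl⟩]
    refine ih hN hP le_sup_left ?_
    intro x hx
    obtain ⟨y, hy, _, ⟨z, hz, rfl⟩, rfl⟩ := Submodule.mem_sup.1 hx
    rw [smul_add]
    refine add_mem (N.smul_mem _ hy) ?_
    change π ^ n • π • z ∈ N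
    rw [smul_smul, ← pow_succ]
    exact hπM z hz

theorem red_eq_of_le {N M : Submodule A V} (hN : IsLattice ρ N) (hM : IsLattice ρ M)
    (hNM : N ≤ M) : hN.red = hM.red := by
  obtain ⟨a, ha, haM⟩ := exists_smul_le hN.span_eq_top hM.fg
  obtain ⟨π, hπ⟩ := IsPrincipalIdealRing.principal (maximalIdeal A)
  by_cases hA : maximalIdeal A = ⊥
  · have hu : IsUnit a := by
      by_contra h
      have : a ∈ maximalIdeal A := h
      rw [hA] at this
      exact ha this
    have : N = M := le_antisymm hNM fun x hx =>
      (Submodule.smul_mem_iff_of_isUnit N hu).1 (haM x hx)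
    subst this
    rfl
  · have : IsDiscreteValuationRing A := ⟨hA⟩
    have hπ0 : π ≠ 0 := by
      rintro rfl
      exact hA (by simpa using hπ)
    have hirr := (IsDiscreteValuationRing.irreducible_iff_uniformizer π).2 hπ
    obtain ⟨n, hn⟩ := IsDiscreteValuationRing.associated_pow_irreducible ha hirr
    obtain ⟨u, hu⟩ := hn
    refine red_eq_of_pow hπ hπ0 n hN hM hNM fun x hx => ?_
    rw [← hu, mul_comm, mul_smul]
    exact N.smul_mem _ (haM x hx)

/-- The class of the reduction of a lattice does not depend on the lattice. -/
theorem red_eq {N M : Submodule A V} (hN : IsLattice ρ N) (hM : IsLattice ρ M) :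
    hN.red = hM.red := by
  have h : IsLattice ρ (N ⊔ M) := by
    refine ⟨hN.fg.sup hM.fg, ?_, ?_⟩
    · rw [eq_top_iff, ← hN.span_eq_top]
      exact Submodule.span_mono (fun x hx => Submodule.mem_sup_left hx)
    · intro g x hx
      obtain ⟨y, hy, z, hz, rfl⟩ := Submodule.mem_sup.1 hx
      rw [map_add]
      exact Submodule.add_mem_sup (hN.stable g y hy) (hM.stable g z hz)
  rw [red_eq_of_le hN h le_sup_left, red_eq_of_le hM h le_sup_right]

theorem red_exact (f : V →ₗ[K] V') (h : V' →ₗ[K] V'')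
    (hf' : ∀ g x, f (ρ g x) = ρ' g (f x)) (hh' : ∀ g x, h (ρ' g x) = ρ'' g (h x))
    (hf : Function.Injective f) (hfh : Function.Exact f h) (hh : Function.Surjective h)
    {L : Submodule A V} {L' : Submodule A V'} {L'' : Submodule A V''} (hL : IsLattice ρ L)
    (hL' : IsLattice ρ' L') (hL'' : IsLattice ρ'' L'') : hL'.red = hL.red + hL''.red := by
  obtain ⟨π, hπ⟩ := IsPrincipalIdealRing.principal (maximalIdeal A)
  have hinj : Function.Injective (algebraMap A K) := IsFractionRing.injective A K
  let L₁ : Submodule A V := L'.comap (f.restrictScalars A)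
  let L₃ : Submodule A V'' := L'.map (h.restrictScalars A)
  have h1 : IsLattice ρ L₁ := by
    have := Module.Finite.iff_fg.2 hL'.fg
    refine ⟨?_, ?_, ?_⟩
    · rw [← Module.Finite.iff_fg]
      exact Module.Finite.of_injective
        ((f.restrictScalars A).restrict (p := L₁) (q := L') fun x hx => hx)
        fun x y hxy => Subtype.ext (hf (congrArg Subtype.val hxy))
    · rw [eq_top_iff]
      intro x _
      obtain ⟨a, ha, hax⟩ := exists_smul_mem hL'.span_eq_top (f x)
      have ha' : algebraMap A K a ≠ 0 := by simpa using hinj.ne ha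
      have h2 : a • x ∈ L₁ := by
        change f (a • x) ∈ L'
        rwa [← algebraMap_smul K a x, map_smul, algebraMap_smul]
      have h3 := Submodule.smul_mem _ (algebraMap A K a)⁻¹
        (Submodule.subset_span (R := K) (s := (L₁ : Set V)) h2)
      rwa [← algebraMap_smul K a x, inv_smul_smul₀ ha'] at h3
    · intro g x hx
      change f (ρ g x) ∈ L'
      rw [hf']
      exact hL'.stable g _ hx
  have h3 : IsLattice ρ'' L₃ := by
    refine ⟨hL'.fg.map _, ?_, ?_⟩
    · have : (L₃ : Set V'') = h '' L' := rfl
      rw [this, Submodule.span_image, hL'.span_eq_top, Submodule.map_top,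
        LinearMap.range_eq_top.2 hh]
    · rintro g _ ⟨x, hx, rfl⟩
      exact ⟨ρ' g x, hL'.stable g x hx, hh' g x⟩
  rw [red_eq hL h1, red_eq hL'' h3]
  have := Module.Finite.iff_fg.2 hL'.fg
  have := Module.Finite.iff_fg.2 h1.fg
  have := Module.Finite.iff_fg.2 h3.fg
  refine cls_residual_exact hπ
    ((f.restrictScalars A).restrict (p := L₁) (q := L') fun x hx => hx)
    ((h.restrictScalars A).restrict (p := L') (q := L₃) fun x hx => ⟨x, hx, rfl⟩) ?_ ?_ ?_ ?_ ?_
  · exact fun g x => Subtype.ext (hf' g x)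
  · exact fun g x => Subtype.ext (hh' g x)
  · intro y
    constructor
    · intro hy
      obtain ⟨x, hx⟩ := (hfh y).1 (congrArg Subtype.val hy)
      have hxL : f x ∈ L' := hx ▸ y.2
      exact ⟨⟨x, hxL⟩, Subtype.ext hx⟩
    · rintro ⟨x, rfl⟩
      exact Subtype.ext ((hfh _).2 ⟨x, rfl⟩)
  · rintro ⟨_, x, hx, rfl⟩
    exact ⟨⟨x, hx⟩, rfl⟩
  · rintro ⟨x, hx⟩ ⟨y, hy⟩ hxy
    have hxy : f x = π • y := congrArg Subtype.val hxy
    by_cases hπ0 : π = 0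
    · subst hπ0
      rw [zero_smul] at hxy
      have : x = 0 := hf (by rw [hxy, map_zero])
      subst this
      exact ⟨0, by simp; rfl⟩
    · have hπ' : algebraMap A K π ≠ 0 := by simpa using hinj.ne hπ0
      have h4 : f ((algebraMap A K π)⁻¹ • x) = y := by
        rw [map_smul, hxy, ← algebraMap_smul K π y, inv_smul_smul₀ hπ']
      refine ⟨⟨(algebraMap A K π)⁻¹ • x, by change f _ ∈ L'; rwa [h4]⟩, Subtype.ext ?_⟩
      change π • (algebraMap A K π)⁻¹ • x = x
      rw [← algebraMap_smul K π, smul_inv_smul₀ hπ']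

end Lattice

variable [IsDomain A] [IsPrincipalIdealRing A] [IsFractionRing A K] [Finite G]

variable (A G K) in
/-- The decomposition map `R(KG) → R(kG)`, where `k` is the residue field of `A`. It sends the class
of a `KG`-module to the class of the reduction `k ⊗ L` of any `G`-stable lattice `L` in it. -/
noncomputable def decompositionMap : Groth K G →+ Groth (ResidueField A) G :=
  Groth.lift (fun a : CoordRep K G => (exists_isLattice A a.2).choose_spec.red) <| by
    intro a b c f h h1 h2 h3
    exact red_exact f.toLinearMap h.toLinearMap (f.isIntertwining _ _) (h.isIntertwining _ _) h1 h2 h3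
      _ _ _

theorem decompositionMap_cls {V : Type*} [AddCommGroup V] [Module K V] [Module A V]
    [IsScalarTower A K V] [FiniteDimensional K V] (ρ : Representation K G V) (L : Submodule A V)
    (hL : IsLattice ρ L) : decompositionMap A G K (cls ρ) = hL.red := by
  rw [decompositionMap, Groth.lift_cls]
  have e := coordRepEquiv ρ
  have h0 : IsLattice (1 : Representation K G (Fin 0 → K)) (⊥ : Submodule A (Fin 0 → K)) :=
    ⟨Submodule.fg_bot, Subsingleton.elim _ _, fun g x hx => hx⟩
  have h1 := red_exact e.toIntertwiningMap.toLinearMap 0 (e.toIntertwiningMap.isIntertwining _ _)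
    (fun g x => Subsingleton.elim _ _)
    e.injective (fun x => ⟨fun _ => e.surjective x, fun _ => rfl⟩)
    (fun x => ⟨0, Subsingleton.elim _ _⟩) hL (exists_isLattice A (coordRep ρ).2).choose_spec h0
  have h2 := red_exact (ρ := (1 : Representation K G (Fin 0 → K))) 0 0
    (fun g x => Subsingleton.elim _ _) (fun g x => Subsingleton.elim _ _)
    (fun x y _ => Subsingleton.elim _ _)
    (fun x => ⟨fun _ => ⟨0, Subsingleton.elim _ _⟩, fun _ => rfl⟩)
    (fun x => ⟨0, Subsingleton.elim _ _⟩) h0 h0 h0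
  rw [h1, left_eq_add.1 h2, add_zero]

end Decomposition


section Setting

/-- The localization of a Dedekind domain at a prime ideal is a principal ideal domain. -/
instance isPrincipalIdealRing_atPrime {O : Type u} [CommRing O] [IsDedekindDomain O]
    (P : Ideal O) [P.IsPrime] : IsPrincipalIdealRing (Localization.AtPrime P) := by
  by_cases hP : P = ⊥
  · subst hP
    have : IsFractionRing O (Localization.AtPrime (⊥ : Ideal O)) := by
      have h : (⊥ : Ideal O).primeCompl = nonZeroDivisors O := by
        ext x
        simp [Ideal.primeCompl, mem_nonZeroDivisors_iff_ne_zero]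
      rw [IsFractionRing, ← h]
      infer_instance
    let := IsFractionRing.toField O (K := Localization.AtPrime (⊥ : Ideal O))
    infer_instance
  · have := IsLocalization.AtPrime.isDiscreteValuationRing_of_dedekind_domain O hP
      (Localization.AtPrime P)
    infer_instance

/-- The decomposition map `R(KG) → R(kG)` at a prime ideal `P` of a Dedekind domain `O` with
fraction field `K`, where `k` is the residue field of `O` at `P`. -/
noncomputable def decompositionMapAt {O : Type u} [CommRing O] [IsDedekindDomain O] (P : Ideal O)
    [P.IsPrime] (K : Type w) [Field K] [Algebra O K] [IsFractionRing O K]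
    [Algebra (Localization.AtPrime P) K] [IsScalarTower O (Localization.AtPrime P) K]
    (G : Type v) [Group G] [Finite G] : Groth K G →+ Groth P.ResidueField G :=
  haveI : IsFractionRing (Localization.AtPrime P) K :=
    IsFractionRing.isFractionRing_of_isDomain_of_isLocalization P.primeCompl _ _
  decompositionMap (Localization.AtPrime P) G K

/-- A conjugacy class is `p`-regular if its elements have order prime to `p`. -/
def IsPRegular {G : Type v} [Group G] (p : ℕ) (C : ConjClasses G) : Prop :=
  ∀ g ∈ C.carrier, ¬ p ∣ orderOf g

/-- A (finite-dimensional) algebra `A` over a field `F` is split if every endomorphism of every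
simple `A`-module is multiplication by a scalar of `F`. -/
def IsSplit (F : Type u) (A : Type v) [Field F] [Ring A] [Algebra F A] : Prop :=
  ∀ (S : Type v) [AddCommGroup S] [Module A S] [IsSimpleModule A S] (f : S →ₗ[A] S),
    ∃ c : F, ∀ s : S, f s = algebraMap F A c • s

/-- `F` is a splitting field for `G` if the group algebra `FG` is split. -/
def IsSplittingFieldFor (F : Type u) (G : Type v) [Field F] [Group G] : Prop :=
  IsSplit F (MonoidAlgebra F G)

/-- The irreducible characters of an algebra `A` over a field `F`: the functions sending `a` to the
trace of `a` on `S`, for `S` a finite-dimensional simple `A`-module. -/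
def irr (F : Type u) (A : Type v) [Field F] [Ring A] [Algebra F A] : Set (A →ₗ[F] F) :=
  {φ | ∃ (S : Type v) (_ : AddCommGroup S) (_ : Module F S) (_ : Module A S)
    (_ : IsScalarTower F A S), IsSimpleModule A S ∧ FiniteDimensional F S ∧
      ∀ a : A, φ a = LinearMap.trace F S (Algebra.lsmul F F S a)}

/-- The module with underlying space `k` on which `a` acts by multiplication by `φ a`. -/
def CharModule {k : Type u} {A : Type v} [Field k] [Ring A] [Algebra k A] (_ : A →ₐ[k] k) :
    Type u := k

noncomputable instance {k : Type u} {A : Type v} [Field k] [Ring A] [Algebra k A] (φ : A →ₐ[k] k) :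
    AddCommGroup (CharModule φ) := inferInstanceAs (AddCommGroup k)

noncomputable instance {k : Type u} {A : Type v} [Field k] [Ring A] [Algebra k A] (φ : A →ₐ[k] k) :
    Module A (CharModule φ) := Module.compHom k (φ : A →+* k)

end Setting

end CharacterRing

/-!
Write `k` for the residue field and `R = k ⊗ R(KG)`. The reduced evaluations at conjugacy classes
are finitely many `k`-algebra homomorphisms `R → k`, and all assertions follow once it is known
which elements they kill and which of them coincide.

*They detect elements up to nilpotents* (`isNilpotent_of_forall_evBar_eq_zero`). The characters of
irreducible modules over a splitting field of any characteristic are linearly independent, by the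
density theorem (`eq_zero_of_sum_character_eq_zero`). Over `K` this shows that an element `z` of
`O ⊗ R(KG)` is determined by its values, and so satisfies `∏_C (z - z(C)) = 0`. If all values of `z`
lie in the prime ideal, this reduces to `z ^ n = 0` in `R`. Hence the kernels of the evaluations are
the only maximal ideals of `R`, and every simple `R`-module is one-dimensional, given by one of them
(`exists_equiv_charModule`).

*They factor through the decomposition map* `d` (`evBar_mk_eq`), since traces can be computed on a
lattice. Over `k`, a commuting `p`-element changes an operator by a nilpotent one, so the evaluation
at `g` equals that at the `p`-regular part of `g` (`characterHom_mul_eq`). Linear independence of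
characters, now over `k`, shows that the kernel of `d` is the joint kernel of the evaluations at
`p`-regular classes, which is the Jacobson radical.

*Distinct regular classes give distinct evaluations* (`exists_evBar_separating`). Let `x` be
`p`-regular and `Q` a Sylow `p`-subgroup of its centralizer. The virtual character with coefficient
`tr(x⁻¹ | V^Q)` at each irreducible `V` has coefficients in `O`. By column orthogonality, its value
at a `p`-regular element is the index of `Q` in the centralizer if the element is conjugate to `x`,
and zero otherwise. That index is prime to `p`. Column orthogonality itself holds because `KG` is a
product of matrix algebras over `K`: it computes the trace of `x ↦ g x h` in two ways.
-/

namespace CharacterRing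

/-! ### Traces on simple modules of a split algebra -/

section Split

variable {F A : Type*} [Field F] [Ring A] [Algebra F A]

/-- The condition `IsSplit`, which speaks of simple modules in the universe of the algebra, passes
to simple modules in every universe, as these are quotients of the algebra. -/
theorem IsSplit.exists_smul (h : IsSplit F A) {S : Type*} [AddCommGroup S] [Module A S]
    [IsSimpleModule A S] (f : S →ₗ[A] S) : ∃ c : F, ∀ s : S, f s = algebraMap F A c • s := by
  obtain ⟨I, hI, ⟨e⟩⟩ := isSimpleModule_iff_quot_maximal.1 ‹IsSimpleModule A S›
  have : IsSimpleModule A (A ⧸ I) := .congr e.symm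
  obtain ⟨c, hc⟩ := h (A ⧸ I) (e.toLinearMap ∘ₗ f ∘ₗ e.symm.toLinearMap)
  refine ⟨c, fun s => e.injective ?_⟩
  simpa using hc (e s)

variable {ι : Type*} [Finite ι] {S : ι → Type*} [∀ i, AddCommGroup (S i)] [∀ i, Module F (S i)]
  [∀ i, Module A (S i)] [∀ i, IsScalarTower F A (S i)] [∀ i, IsSimpleModule A (S i)]

/-- An endomorphism of a sum of pairwise non-isomorphic simple modules over a split algebra acts on
each summand as a scalar (Schur's lemma). -/
theorem IsSplit.exists_end_pi_apply (h : IsSplit F A)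
    (hS : ∀ i j, i ≠ j → IsEmpty (S i ≃ₗ[A] S j)) (φ : Module.End A (∀ i, S i)) :
    ∃ c : ι → F, ∀ m i, φ m i = c i • m i := by
  classical
  cases nonempty_fintype ι
  choose c hc using fun i => h.exists_smul ((LinearMap.proj i ∘ₗ φ) ∘ₗ LinearMap.single A S i)
  refine ⟨c, fun m i => ?_⟩
  have hz : ∀ l, l ≠ i → φ (Pi.single l (m l)) i = 0 := by
    intro l hl
    rcases LinearMap.bijective_or_eq_zero
      ((LinearMap.proj i ∘ₗ φ) ∘ₗ LinearMap.single A S l) with hb | h0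
    · exact ((hS l i hl).false (LinearEquiv.ofBijective _ hb)).elim
    · exact LinearMap.congr_fun h0 (m l)
  have hm : φ m i = ∑ l, φ (Pi.single l (m l)) i := by
    conv_lhs => rw [← Finset.univ_sum_single m, map_sum, Finset.sum_apply]
  rw [hm, Finset.sum_eq_single i (fun l _ hl => hz l hl) (by simp)]
  simpa using hc i (m i)

/-- Given pairwise non-isomorphic simple modules over a split algebra, the density theorem provides
an element that acts on one of them as an operator of trace `1` and on the others as zero. -/
theorem IsSplit.exists_trace_eq_ite [DecidableEq ι] [∀ i, FiniteDimensional F (S i)]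
    (h : IsSplit F A)
    (hS : ∀ i j, i ≠ j → IsEmpty (S i ≃ₗ[A] S j)) (j : ι) :
    ∃ a : A, ∀ i, LinearMap.trace F (S i) (Algebra.lsmul F F (S i) a) = if i = j then 1 else 0 := by
  classical
  obtain ⟨E, hE⟩ : ∃ E : Module.End F (S j), LinearMap.trace F (S j) E = 1 := by
    have : Nontrivial (S j) := IsSimpleModule.nontrivial A (S j)
    obtain ⟨v, hv⟩ := exists_ne (0 : S j)
    obtain ⟨f, hf⟩ := Module.Projective.exists_dual_eq_one F hv
    exact ⟨f.smulRight v, by rw [LinearMap.trace_smulRight, hf]⟩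
  -- `T` acts as `E` on the factor `S j` and as zero on the others. It commutes with the module
  -- endomorphisms, which are diagonal with scalar entries.
  let T : Module.End F (∀ i, S i) := LinearMap.single F S j ∘ₗ E ∘ₗ LinearMap.proj j
  let f : Module.End (Module.End A (∀ i, S i)) (∀ i, S i) :=
    { toFun := T
      map_add' := map_add T
      map_smul' := fun φ m => by
        obtain ⟨c, hc⟩ := h.exists_end_pi_apply hS φ
        ext i
        simp only [Module.End.smul_def, RingHom.id_apply, hc]
        rcases eq_or_ne i j with rfl | hij
        · simp [T, hc]
        · simp [T, hij] }
  let b := Module.finBasis F (∀ i, S i)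
  obtain ⟨a, ha⟩ := jacobson_density f (Finset.univ.image b)
  have ha' : Algebra.lsmul F F (∀ i, S i) a = T :=
    b.ext fun l => (ha (b l) (by simp)).symm
  refine ⟨a, fun i => ?_⟩
  have hi : Algebra.lsmul F F (S i) a = LinearMap.proj i ∘ₗ T ∘ₗ LinearMap.single F S i := by
    ext s
    rw [← ha']
    simp
  rw [hi]
  split_ifs with hij
  · subst hij
    rw [← hE]
    congr 1
    ext s
    simp [T]
  · convert LinearMap.map_zero _
    ext s
    simp [T, hij]

end Split

/-! ### Simple classes and linear independence of characters -/

section Simple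

universe u v

variable {F : Type u} [Field F] {G : Type v} [Group G]

/-- The Grothendieck group is generated by the classes of the irreducible representations: a
representation that is not irreducible is an extension of two of smaller dimension. -/
theorem cls_mem_closure_irreducible (n : ℕ) (a : CoordRep F G) (ha : a.1 ≤ n) :
    cls a.2 ∈ AddSubgroup.closure
      {x : Groth F G | ∃ b : CoordRep F G, b.2.IsIrreducible ∧ cls b.2 = x} := by
  induction n generalizing a with
  | zero =>
    have : IsEmpty (Fin a.1) := by rw [Nat.le_zero.1 ha]; infer_instance
    have h := cls_exact (ρ₁ := a.2) (ρ₂ := a.2) (ρ₃ := a.2) 0 0 (fun _ _ => Subsingleton.elim _ _)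
      (fun _ _ => Subsingleton.elim _ _) (fun _ _ _ => Subsingleton.elim _ _)
      (fun x => ⟨fun _ => ⟨0, Subsingleton.elim _ _⟩, fun _ => rfl⟩)
      (fun x => ⟨0, Subsingleton.elim _ _⟩)
    rw [left_eq_add.1 h]
    exact zero_mem _
  | succ n ih =>
    by_cases hirr : a.2.IsIrreducible
    · exact AddSubgroup.subset_closure ⟨a, hirr, rfl⟩
    by_cases h0 : a.1 = 0
    · exact ih a (by omega)
    have hnt : Nontrivial (Subrepresentation a.2) := by
      have : Nonempty (Fin a.1) := ⟨⟨0, Nat.pos_of_ne_zero h0⟩⟩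
      refine ⟨⊥, ⊤, fun h => ?_⟩
      exact bot_ne_top (congrArg Subrepresentation.toSubmodule h :
        (⊥ : Submodule F (Fin a.1 → F)) = ⊤)
    obtain ⟨W, hW0, hW1⟩ : ∃ W : Subrepresentation a.2, W ≠ ⊥ ∧ W ≠ ⊤ := by
      by_contra! hW
      exact hirr ⟨fun W => or_iff_not_imp_left.2 (hW W)⟩
    have hW0' : W.toSubmodule ≠ ⊥ := fun h => hW0 (Subrepresentation.toSubmodule_injective h)
    have hW1' : W.toSubmodule ≠ ⊤ := fun h => hW1 (Subrepresentation.toSubmodule_injective h)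
    have hd := W.toSubmodule.finrank_quotient_add_finrank
    rw [Module.finrank_fin_fun] at hd
    have hpos := Submodule.one_le_finrank_iff.2 hW0'
    have hlt := Submodule.finrank_lt hW1'
    rw [Module.finrank_fin_fun] at hlt
    have hle : ∀ g, W.toSubmodule ≤ W.toSubmodule.comap (a.2 g) := W.apply_mem_toSubmodule
    have key : cls a.2 = cls (a.2.subrepresentation W.toSubmodule hle) +
        cls (a.2.quotient W.toSubmodule hle) :=
      cls_exact W.toSubmodule.subtype W.toSubmodule.mkQ (fun _ _ => rfl) (fun _ _ => rfl)
        (Submodule.injective_subtype _) (LinearMap.exact_subtype_mkQ _)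
        (Submodule.mkQ_surjective _)
    rw [key, cls_iso (coordRepEquiv (a.2.subrepresentation W.toSubmodule hle)),
      cls_iso (coordRepEquiv (a.2.quotient W.toSubmodule hle))]
    refine add_mem (ih _ ?_) (ih _ ?_)
    · change Module.finrank F W.toSubmodule ≤ n
      omega
    · change Module.finrank F (_ ⧸ W.toSubmodule) ≤ n
      omega

variable (F G) in
/-- Isomorphism of irreducible representations in coordinates. -/
def irrSetoid : Setoid {a : CoordRep F G // a.2.IsIrreducible} where
  r a b := Nonempty (a.1.2.Equiv b.1.2)
  iseqv := ⟨fun _ => ⟨.refl _⟩, fun ⟨e⟩ => ⟨e.symm⟩, fun ⟨e⟩ ⟨f⟩ => ⟨e.trans f⟩⟩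

variable (F G) in
/-- The isomorphism classes of irreducible representations. -/
abbrev IrrClass := Quotient (irrSetoid F G)

/-- A representation in a given isomorphism class of irreducible representations. -/
noncomputable def IrrClass.out (i : IrrClass F G) : CoordRep F G := (Quotient.out i).1

instance (i : IrrClass F G) : i.out.2.IsIrreducible := (Quotient.out i).2

theorem IrrClass.eq_of_equiv {i j : IrrClass F G} (e : i.out.2.Equiv j.out.2) : i = j := by
  rw [← Quotient.out_eq i, ← Quotient.out_eq j]
  exact Quotient.sound ⟨e⟩

theorem IrrClass.exists_equiv (a : CoordRep F G) (ha : a.2.IsIrreducible) :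
    ∃ i : IrrClass F G, cls i.out.2 = cls a.2 :=
  ⟨⟦⟨a, ha⟩⟧, cls_iso (Quotient.mk_out (s := irrSetoid F G) ⟨a, ha⟩).some⟩

theorem closure_irrClass : AddSubgroup.closure
    (Set.range fun i : IrrClass F G => (cls i.out.2 : Groth F G)) = ⊤ := by
  rw [eq_top_iff]
  intro x _
  induction x using Groth.induction with
  | h a =>
    refine AddSubgroup.closure_mono ?_ (cls_mem_closure_irreducible a.1 a le_rfl)
    rintro _ ⟨b, hb, rfl⟩
    exact IrrClass.exists_equiv b hb
  | hneg x hx => exact neg_mem (hx trivial)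
  | hadd x y hx hy => exact add_mem (hx trivial) (hy trivial)

theorem trace_lsmul_asModule {V : Type*} [AddCommGroup V] [Module F V]
    (ρ : Representation F G V) (a : MonoidAlgebra F G) :
    LinearMap.trace F ρ.asModule (Algebra.lsmul F F ρ.asModule a) =
      ∑ g ∈ a.coeff.support, a.coeff g * ρ.character g := by
  have h : Algebra.lsmul F F ρ.asModule a = ρ.asAlgebraHom a := by
    ext x
    exact ρ.asModuleEquiv_map_smul a x
  rw [h]
  change LinearMap.trace F V (ρ.asAlgebraHom a) = _
  rw [Representation.asAlgebraHom_def, MonoidAlgebra.lift_apply, Finsupp.sum, map_sum]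
  simp [Representation.character]

/-- Over a splitting field, of any characteristic, the characters of the irreducible representations
are linearly independent. -/
theorem eq_zero_of_sum_character_eq_zero (h : IsSplittingFieldFor F G) (s : Finset (IrrClass F G))
    (c : IrrClass F G → F) (hc : ∀ g, ∑ i ∈ s, c i * i.out.2.character g = 0)
    (j : IrrClass F G) (hj : j ∈ s) : c j = 0 := by
  classical
  have hS : ∀ i j : s, i ≠ j →
      IsEmpty (i.1.out.2.asModule ≃ₗ[MonoidAlgebra F G] j.1.out.2.asModule) := by
    refine fun i j hij => ⟨fun e => hij (Subtype.ext (IrrClass.eq_of_equiv ?_))⟩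
    let f := (Representation.IntertwiningMap.equivLinearMapAsModule i.1.out.2 j.1.out.2).symm
      e.toLinearMap
    exact f.ofBijective e.bijective
  obtain ⟨a, ha⟩ := IsSplit.exists_trace_eq_ite (F := F) h hS ⟨j, hj⟩
  have h1 : ∑ i ∈ s, c i * LinearMap.trace F _ (Algebra.lsmul F F i.out.2.asModule a) = 0 := by
    simp only [trace_lsmul_asModule, Finset.mul_sum]
    rw [Finset.sum_comm]
    refine Finset.sum_eq_zero fun g _ => ?_
    rw [← mul_zero (a.coeff g), ← hc g, Finset.mul_sum]
    exact Finset.sum_congr rfl fun i _ => mul_left_comm _ _ _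
  rw [← Finset.sum_coe_sort] at h1
  simpa [ha] using h1

/-- Over a splitting field `F`, an element of `A ⊗ R(FG)`, for a subring `A` of `F`, is determined
by the values of the corresponding combination of characters. -/
theorem eq_zero_of_forall_eval_eq_zero (h : IsSplittingFieldFor F G) {A : Type*} [CommRing A]
    (φ : A →+* F) (hφ : Function.Injective φ) (E : G → (A ⊗[ℤ] Groth F G →+ F))
    (hE : ∀ g a x, E g (a ⊗ₜ x) = φ a * characterHom g x) (z : A ⊗[ℤ] Groth F G)
    (hz : ∀ g, E g z = 0) : z = 0 := by
  have hspan : z ∈ Submodule.span A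
      (Set.range fun i : IrrClass F G => (1 : A) ⊗ₜ[ℤ] (cls i.out.2 : Groth F G)) := by
    have h1 : ∀ x : Groth F G, (1 : A) ⊗ₜ[ℤ] x ∈ Submodule.span A
        (Set.range fun i : IrrClass F G => (1 : A) ⊗ₜ[ℤ] (cls i.out.2 : Groth F G)) := by
      intro x
      have hx : x ∈ AddSubgroup.closure
          (Set.range fun i : IrrClass F G => (cls i.out.2 : Groth F G)) :=
        (closure_irrClass (F := F) (G := G)).symm ▸ AddSubgroup.mem_top x
      induction hx using AddSubgroup.closure_induction with
      | mem x hx =>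
        obtain ⟨i, rfl⟩ := hx
        exact Submodule.subset_span ⟨i, rfl⟩
      | zero => rw [TensorProduct.tmul_zero]; exact zero_mem _
      | add x y _ _ hx hy => rw [TensorProduct.tmul_add]; exact add_mem hx hy
      | neg x _ hx => rw [TensorProduct.tmul_neg]; exact neg_mem hx
    clear hz
    induction z with
    | zero => exact zero_mem _
    | add x y hx hy => exact add_mem hx hy
    | tmul a x =>
      have := Submodule.smul_mem _ a (h1 x)
      rwa [TensorProduct.smul_tmul', smul_eq_mul, mul_one] at this
  obtain ⟨c, rfl⟩ := Finsupp.mem_span_range_iff_exists_finsupp.1 hspan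
  have h0 : ∀ i ∈ c.support, φ (c i) = 0 := by
    refine eq_zero_of_sum_character_eq_zero h c.support (fun i => φ (c i)) fun g => ?_
    rw [← hz g, Finsupp.sum, map_sum]
    refine Finset.sum_congr rfl fun i _ => ?_
    rw [TensorProduct.smul_tmul', smul_eq_mul, mul_one, hE, characterHom_cls]
  refine Finset.sum_eq_zero fun i hi => ?_
  rw [hφ ((h0 i hi).trans (map_zero φ).symm)]
  exact zero_smul _ _

end Simple

/-! ### Characters and the decomposition map -/

section Decomposition

open IsLocalRing

variable {A : Type*} [CommRing A] [IsLocalRing A] [IsDomain A] [IsPrincipalIdealRing A]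
  {K : Type*} [Field K] [Algebra A K] [IsFractionRing A K] {G : Type*} [Group G]
  {V : Type*} [AddCommGroup V] [Module K V] [Module A V] [IsScalarTower A K V]
  {ρ : Representation K G V} {L : Submodule A V}

theorem IsLattice.free (hL : IsLattice ρ L) : Module.Free A L :=
  have : Submodule.IsLattice K L := ⟨hL.fg, hL.span_eq_top⟩
  Submodule.IsLattice.free K L

/-- An `A`-basis of a lattice is a `K`-basis of the ambient space, so that the trace of `g` can be
computed on the lattice. -/
theorem IsLattice.character_eq (hL : IsLattice ρ L) (g : G) :
    ρ.character g = algebraMap A K (LinearMap.trace A L (hL.rep g)) := by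
  classical
  have : Submodule.IsLattice K L := ⟨hL.fg, hL.span_eq_top⟩
  let b := Module.Free.chooseBasis A L
  let b' := b.extendOfIsLattice K
  have hb : ∀ x : L, ∀ i, b'.repr x i = algebraMap A K (b.repr x i) := by
    intro x
    have hx : (x : V) = ∑ i, algebraMap A K (b.repr x i) • b' i := by
      conv_lhs => rw [← b.sum_repr x]
      simp [b', -Module.Basis.sum_repr]
    intro i
    rw [hx, b'.repr_sum_self]
  rw [Representation.character, LinearMap.trace_eq_matrix_trace K b',
    LinearMap.trace_eq_matrix_trace A b, Matrix.trace, Matrix.trace, map_sum]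
  refine Finset.sum_congr rfl fun i _ => ?_
  rw [Matrix.diag_apply, Matrix.diag_apply, LinearMap.toMatrix_apply, LinearMap.toMatrix_apply,
    ← hb, Module.Basis.extendOfIsLattice_apply]
  rfl

theorem IsLattice.character_residual (hL : IsLattice ρ L) (g : G) :
    (residual hL.rep).character g =
      algebraMap A (ResidueField A) (LinearMap.trace A L (hL.rep g)) := by
  have := hL.free
  have := Module.Finite.iff_fg.2 hL.fg
  exact LinearMap.trace_baseChange _ _

/-- The Brauer character relation: reducing a character value of `V` modulo the maximal ideal gives
the value of the character of the reduction of `V`. -/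
theorem exists_algebraMap_eq_characterHom [Finite G] (g : G) (x : Groth K G) :
    ∃ a : A, algebraMap A K a = characterHom g x ∧
      algebraMap A (ResidueField A) a = characterHom g (decompositionMap A G K x) := by
  induction x using Groth.induction with
  | h a =>
    obtain ⟨L, hL⟩ := exists_isLattice A a.2
    have := Module.Finite.iff_fg.2 hL.fg
    refine ⟨LinearMap.trace A L (hL.rep g), ?_, ?_⟩
    · rw [characterHom_cls, hL.character_eq]
    · rw [decompositionMap_cls a.2 L hL, IsLattice.red, characterHom_cls, hL.character_residual]
  | hneg x hx =>
    obtain ⟨a, h1, h2⟩ := hx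
    exact ⟨-a, by simp only [map_neg, h1], by simp only [map_neg, h2]⟩
  | hadd x y hx hy =>
    obtain ⟨a, h1, h2⟩ := hx
    obtain ⟨b, h3, h4⟩ := hy
    exact ⟨a + b, by simp only [map_add, h1, h3], by simp only [map_add, h2, h4]⟩

end Decomposition

section AtPrime

variable {O : Type*} [CommRing O] [IsDedekindDomain O] (P : Ideal O) [P.IsPrime]
  (K : Type*) [Field K] [Algebra O K] [IsFractionRing O K]
  [Algebra (Localization.AtPrime P) K] [IsScalarTower O (Localization.AtPrime P) K]
  {G : Type*} [Group G] [Finite G]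

/-- The reduction of a character value modulo `P` is the value of the decomposed character. -/
theorem algebraMap_ev_eq_characterHom (g : G) (x : Groth K G) :
    algebraMap O P.ResidueField (ev O (ConjClasses.mk g) x) =
      characterHom g (decompositionMapAt P K G x) := by
  have : IsFractionRing (Localization.AtPrime P) K :=
    IsFractionRing.isFractionRing_of_isDomain_of_isLocalization P.primeCompl _ _
  obtain ⟨a, h1, h2⟩ := exists_algebraMap_eq_characterHom (A := Localization.AtPrime P) g x
  have h3 : algebraMap O (Localization.AtPrime P) (ev O (ConjClasses.mk g) x) = a := by
    apply IsFractionRing.injective (Localization.AtPrime P) K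
    rw [← IsScalarTower.algebraMap_apply, algebraMap_ev, h1]
    rfl
  rw [decompositionMapAt, ← h2, ← h3]
  exact IsScalarTower.algebraMap_apply O (Localization.AtPrime P) P.ResidueField _

end AtPrime

section CharBar

variable {k : Type*} [Field k] {G : Type*} [Group G]

variable (k) in
/-- The value at `g` of the virtual characters of `kG`, extended `k`-linearly to `k ⊗ R(kG)`. -/
noncomputable def charBar (g : G) : ScalarGroth k k G →ₐ[k] k :=
  Algebra.TensorProduct.lift (AlgHom.id k k) (characterHom g).toIntAlgHom fun _ _ => Commute.all _ _

theorem charBar_tmul (g : G) (c : k) (x : Groth k G) :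
    charBar k g (c ⊗ₜ[ℤ] x : k ⊗[ℤ] Groth k G) = c * characterHom g x :=
  Algebra.TensorProduct.lift_tmul _ _ _ _ _

variable {F : Type*} [Field F]

/-- The elementary tensors span `k ⊗ R(FG)`. -/
theorem ScalarGroth.addHom_ext {H : Type*} [AddCommMonoid H] {φ ψ : ScalarGroth k F G →+ H}
    (h : ∀ (c : k) (x : Groth F G), φ (c ⊗ₜ[ℤ] x : k ⊗[ℤ] Groth F G) =
      ψ (c ⊗ₜ[ℤ] x : k ⊗[ℤ] Groth F G)) : φ = ψ := by
  refine AddMonoidHom.ext fun z => ?_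
  induction z using TensorProduct.induction_on with
  | zero => exact (map_zero φ).trans (map_zero ψ).symm
  | add x y hx hy => exact (map_add φ x y).trans ((congrArg₂ _ hx hy).trans (map_add ψ x y).symm)
  | tmul c x => exact h c x

/-- An evaluation `R(KG) → O → k` that factors through an additive map `d : R(KG) → R(kG)` does so
after extending scalars to `k`. -/
theorem evBar_mk_eq {O K : Type*} [CommRing O] [IsIntegrallyClosed O] [Field K] [Algebra O K]
    [IsFractionRing O K] [Finite G] [Algebra O k] (d : Groth K G →+ Groth k G) (g : G)
    (hd : ∀ x, algebraMap O k (ev O (ConjClasses.mk g) x) = characterHom g (d x))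
    (z : ScalarGroth k K G) :
    evBar K O k (ConjClasses.mk g) z = charBar k g (scalarMap k d z) := by
  refine DFunLike.congr_fun (ScalarGroth.addHom_ext
    (φ := (evBar K O k (ConjClasses.mk g) : ScalarGroth k K G →+ k))
    (ψ := ((charBar k g : ScalarGroth k k G →+ k).comp
      (scalarMap k d : ScalarGroth k K G →+ ScalarGroth k k G))) fun c x => ?_) z
  exact (evBar_tmul O k (ConjClasses.mk g) c x).trans
    ((congrArg (c * ·) (hd x)).trans (charBar_tmul g c (d x)).symm)

end CharBar

/-! ### Regular parts -/

section Regular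

variable {F : Type*} [Field F] {p : ℕ} [Fact p.Prime] {G : Type*} [Group G]

/-- Multiplying by a commuting `p`-element changes an operator by a nilpotent one, so in
characteristic `p` it does not change traces. -/
theorem characterHom_mul_eq [CharP F p] {u s : G} (h : Commute u s) {n : ℕ} (hu : u ^ p ^ n = 1) :
    (characterHom (u * s) : Groth F G →+* F) = characterHom s := by
  refine characterHom_ext fun a => ?_
  have hnil : (a.2 u - 1) ^ p ^ n = 0 := by
    -- The identity `(X - 1) ^ p ^ n = X ^ p ^ n - 1` is taken from `F[X]`, because the endomorphism
    -- ring has characteristic `1` when the representation is zero.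
    have h1 := congrArg (Polynomial.aeval (a.2 u))
      (sub_pow_char_pow (p := p) (Polynomial.X : Polynomial F) 1 n)
    rwa [map_pow, map_sub, map_sub, one_pow, map_one, map_pow, Polynomial.aeval_X, ← map_pow a.2,
      hu, map_one, sub_self] at h1
  have hc : Commute (a.2 u - 1) (a.2 s) :=
    (show Commute (a.2 u) (a.2 s) from h.map a.2).sub_left (Commute.one_left _)
  have h0 := (LinearMap.isNilpotent_trace_of_isNilpotent
    (hc.isNilpotent_mul_right ⟨_, hnil⟩)).eq_zero
  rw [sub_mul, one_mul, map_sub, sub_eq_zero, ← map_mul] at h0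
  exact h0

variable (p) in
/-- Every element is the product of its `p`-part and its `p`-regular part, which commute. -/
theorem exists_regular_part [Finite G] (g : G) :
    ∃ u s : G, g = u * s ∧ Commute u s ∧ (∃ n, u ^ p ^ n = 1) ∧ ¬ p ∣ orderOf s := by
  have hp : p.Prime := Fact.out
  obtain ⟨n, m, hm, hg⟩ := Nat.exists_eq_pow_mul_and_not_dvd (orderOf_pos g).ne' p hp.ne_one
  have hco : Nat.Coprime (p ^ n) m :=
    Nat.Coprime.pow_left n ((Nat.Prime.coprime_iff_not_dvd hp).2 hm)
  obtain ⟨N, hN1, hN2⟩ := Nat.chineseRemainder hco 0 1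
  refine ⟨g * (g ^ N)⁻¹, g ^ N, by group, ?_, ⟨n, ?_⟩, fun hdvd => hm ?_⟩
  · exact ((Commute.refl g).mul_left ((Commute.refl g).pow_left N).inv_left).pow_right N
  · rw [(Commute.refl g).pow_right N |>.inv_right.mul_pow, inv_pow, mul_inv_eq_one, ← pow_mul,
      pow_eq_pow_iff_modEq, hg, mul_comm N]
    simpa using (hN2.symm.mul_left' (p ^ n))
  · refine hdvd.trans (orderOf_dvd_of_pow_eq_one ?_)
    rw [← pow_mul, ← orderOf_dvd_iff_pow_eq_one, hg]
    exact mul_dvd_mul ((Nat.modEq_zero_iff_dvd).1 hN1) dvd_rfl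

omit [Fact p.Prime] in
theorem isPRegular_mk {g : G} : IsPRegular p (ConjClasses.mk g) ↔ ¬ p ∣ orderOf g := by
  refine ⟨fun h => h g ConjClasses.mem_carrier_mk, fun h x hx => ?_⟩
  obtain ⟨c, rfl⟩ := isConj_iff.1
    (ConjClasses.mk_eq_mk_iff_isConj.1 (ConjClasses.mem_carrier_iff_mk_eq.1 hx))
  rwa [← MulAut.conj_apply, MulEquiv.orderOf_eq] at h

end Regular

/-! ### Elements with vanishing evaluations are nilpotent -/

section Nilpotent

variable {O K k : Type*} [CommRing O] [IsIntegrallyClosed O] [Field K] [Algebra O K]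
  [IsFractionRing O K] [Field k] [Algebra O k] {G : Type*} [Group G] [Finite G]

/-- An element `z` of `O ⊗ R(KG)` is a root of `∏ (X - ev_C z)`, the product being over the
conjugacy classes, as this holds after evaluation at each class. -/
theorem exists_evaluation_prod_eq_zero (hK : IsSplittingFieldFor K G) :
    ∃ E : ConjClasses G → (O ⊗[ℤ] Groth K G →ₐ[O] O),
      (∀ C a x, E C (a ⊗ₜ x) = a * ev O C x) ∧
      ∀ z, ∏ᶠ C, (z - algebraMap O (O ⊗[ℤ] Groth K G) (E C z)) = 0 := by
  cases nonempty_fintype (ConjClasses G)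
  let E (C : ConjClasses G) : O ⊗[ℤ] Groth K G →ₐ[O] O :=
    Algebra.TensorProduct.lift (AlgHom.id O O) (ev O C).toIntAlgHom fun _ _ => Commute.all _ _
  have hE : ∀ C a x, E C (a ⊗ₜ x) = a * ev O C x := fun C a x =>
    Algebra.TensorProduct.lift_tmul _ _ _ _ _
  refine ⟨E, hE, fun z => ?_⟩
  rw [finprod_eq_prod_of_fintype]
  refine eq_zero_of_forall_eval_eq_zero hK (algebraMap O K) (IsFractionRing.injective O K)
    (fun g => ((algebraMap O K).comp (E (ConjClasses.mk g) : O ⊗[ℤ] Groth K G →+* O) :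
      O ⊗[ℤ] Groth K G →+* K)) (fun g a x => ?_) _ fun g => ?_
  · change algebraMap O K (E (ConjClasses.mk g) (a ⊗ₜ x)) = _
    rw [hE, map_mul, algebraMap_ev]
    rfl
  · change algebraMap O K (E (ConjClasses.mk g) _) = 0
    rw [map_prod, Finset.prod_eq_zero (Finset.mem_univ (ConjClasses.mk g)), map_zero]
    rw [map_sub, AlgHom.commutes, Algebra.algebraMap_self_apply, sub_self]

/-- The reduced evaluations jointly detect elements up to nilpotents: the relation
`∏ (z - ev_C z) = 0` in `O ⊗ R(KG)` reduces to `z ^ n = 0` if all the evaluations of `z` vanish in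
`k`. -/
theorem isNilpotent_of_forall_evBar_eq_zero (hK : IsSplittingFieldFor K G)
    (hO : Function.Surjective (algebraMap O k)) (z : ScalarGroth k K G)
    (hz : ∀ C, evBar K O k C z = 0) : IsNilpotent z := by
  cases nonempty_fintype (ConjClasses G)
  obtain ⟨E, hE, hprod⟩ := exists_evaluation_prod_eq_zero (O := O) hK
  let π : O ⊗[ℤ] Groth K G →+* ScalarGroth k K G :=
    (Algebra.TensorProduct.map (algebraMap O k).toIntAlgHom (AlgHom.id ℤ (Groth K G)) :
      O ⊗[ℤ] Groth K G →ₐ[ℤ] k ⊗[ℤ] Groth K G).toRingHom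
  have hπ : ∀ a x, π (a ⊗ₜ x) = (algebraMap O k a ⊗ₜ[ℤ] x : k ⊗[ℤ] Groth K G) := fun a x =>
    Algebra.TensorProduct.map_tmul _ _ _ _
  have hsurj : Function.Surjective π := by
    intro w
    induction w using TensorProduct.induction_on with
    | zero => exact ⟨0, map_zero π⟩
    | add x y hx hy =>
      obtain ⟨a, ha⟩ := hx
      obtain ⟨b, hb⟩ := hy
      exact ⟨a + b, (map_add π a b).trans (congrArg₂ _ ha hb)⟩
    | tmul c x =>
      obtain ⟨a, rfl⟩ := hO c
      exact ⟨a ⊗ₜ x, hπ a x⟩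
  have hcomp : ∀ C y, algebraMap O k (E C y) = evBar K O k C (π y) := by
    intro C y
    induction y with
    | zero => simp
    | add x y hx hy => simp only [map_add, hx, hy]
    | tmul a x => rw [hE, hπ, evBar_tmul, map_mul]
  have halg : ∀ a : O, π (algebraMap O _ a) = algebraMap k _ (algebraMap O k a) := fun a => hπ a 1
  obtain ⟨y, rfl⟩ := hsurj z
  refine ⟨Fintype.card (ConjClasses G), ?_⟩
  have h := congrArg π (hprod y)
  rw [finprod_eq_prod_of_fintype, map_prod, map_zero] at h
  have hf : ∀ C, π (y - algebraMap O (O ⊗[ℤ] Groth K G) (E C y)) = π y := fun C => by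
    rw [map_sub, halg, hcomp, hz, map_zero, sub_zero]
  rwa [Finset.prod_congr rfl fun C _ => hf C, Finset.prod_const] at h

end Nilpotent

/-! ### Column orthogonality over a splitting field -/

section Orthogonality

/-- A split semisimple algebra is a product of matrix algebras over the base field. -/
theorem IsSplit.exists_algEquiv_pi_matrix {F A : Type*} [Field F] [Ring A] [Algebra F A]
    [IsSemisimpleRing A] (h : IsSplit F A) :
    ∃ (n : ℕ) (d : Fin n → ℕ), Nonempty (A ≃ₐ[F] ∀ i, Matrix (Fin (d i)) (Fin (d i)) F) := by
  obtain ⟨n, S, d, hS, -, ⟨e⟩⟩ := IsSemisimpleRing.exists_algEquiv_pi_matrix_end_mulOpposite F A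
  refine ⟨n, d, ⟨e.trans (.piCongrRight fun i => .mapMatrix (.symm (.ofBijective
    (Algebra.ofId F (Module.End A (S i))ᵐᵒᵖ) ⟨?_, fun f => ?_⟩)))⟩⟩
  · have : Nontrivial (S i) := IsSimpleModule.nontrivial A (S i)
    exact (algebraMap F (Module.End A (S i))ᵐᵒᵖ).injective
  · obtain ⟨c, hc⟩ := h.exists_smul f.unop
    refine ⟨c, MulOpposite.unop_injective (LinearMap.ext fun s => ?_)⟩
    rw [hc, algebraMap_smul]
    rfl

/-- On a product of matrix algebras, the trace of `M ↦ A * M * B` is `∑ tr(A i) tr(B i)`. -/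
theorem trace_mulLeftRight_pi_matrix {F ι : Type*} [Field F] [Fintype ι] (d : ι → ℕ)
    (A B : ∀ i, Matrix (Fin (d i)) (Fin (d i)) F) :
    LinearMap.trace F _ (LinearMap.mulLeftRight F (A, B)) = ∑ i, (A i).trace * (B i).trace := by
  classical
  rw [LinearMap.trace_eq_matrix_trace F
      (Pi.basis fun i => Matrix.stdBasis F (Fin (d i)) (Fin (d i))),
    Matrix.trace, Fintype.sum_sigma]
  refine Finset.sum_congr rfl fun i _ => ?_
  rw [Fintype.sum_prod_type, Matrix.trace, Matrix.trace, Finset.sum_mul_sum]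
  refine Finset.sum_congr rfl fun a _ => Finset.sum_congr rfl fun b _ => ?_
  rw [Matrix.diag_apply, LinearMap.toMatrix_apply]
  have h1 : (A * Pi.basis (fun i => Matrix.stdBasis F (Fin (d i)) (Fin (d i))) ⟨i, a, b⟩ * B) i =
      A i * Matrix.single a b 1 * B i := by
    simp [Matrix.stdBasis_eq_single]
  rw [LinearMap.mulLeftRight_apply, Pi.basis_repr, h1]
  change (A i * Matrix.single a b (1 : F) * B i : Matrix _ _ F) a b = _
  simp [Matrix.mul_apply, Matrix.single_apply, ite_and]

/-- On the group algebra, the trace of `x ↦ g * x * h` counts the group elements that it fixes. -/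
theorem trace_mulLeftRight_monoidAlgebra {F G : Type*} [Field F] [Group G] [Fintype G]
    [DecidableEq G] (g h : G) :
    LinearMap.trace F _ (LinearMap.mulLeftRight F
      (MonoidAlgebra.of F G g, MonoidAlgebra.of F G h)) =
      ({x | g * x * h = x} : Finset G).card := by
  rw [LinearMap.trace_eq_matrix_trace F (MonoidAlgebra.basis G F), Matrix.trace,
    Finset.card_filter, Nat.cast_sum]
  refine Finset.sum_congr rfl fun x _ => ?_
  rw [Matrix.diag_apply, LinearMap.toMatrix_apply, LinearMap.mulLeftRight_apply]
  have h1 : MonoidAlgebra.of F G g * MonoidAlgebra.basis G F x * MonoidAlgebra.of F G h =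
      MonoidAlgebra.single (g * x * h) 1 := by
    simp [MonoidAlgebra.single_mul_single]
  rw [h1]
  change (Finsupp.single (g * x * h) (1 : F)) x = _
  rw [Finsupp.single_apply, Nat.cast_ite, Nat.cast_one, Nat.cast_zero]

/-- Column orthogonality: for suitable representations over a splitting field, the sum
`∑ χ(g) χ(h)` of products of character values is the number of solutions of `g x h = x`. Both sides
are the trace of `x ↦ g x h` on the group algebra. -/
theorem IsSplittingFieldFor.exists_sum_character_mul {F G : Type*} [Field F] [CharZero F] [Group G]
    [Fintype G] [DecidableEq G] (hF : IsSplittingFieldFor F G) :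
    ∃ (n : ℕ) (d : Fin n → ℕ) (ρ : ∀ i, Representation F G (Fin (d i) → F)), ∀ g h : G,
      ∑ i, (ρ i).character g * (ρ i).character h = ({x | g * x * h = x} : Finset G).card := by
  have : NeZero (Nat.card G : F) := ⟨Nat.cast_ne_zero.2 Nat.card_pos.ne'⟩
  obtain ⟨n, d, ⟨e⟩⟩ := IsSplit.exists_algEquiv_pi_matrix hF
  let ρ (i : Fin n) : Representation F G (Fin (d i) → F) :=
    { toFun g := Matrix.toLin' (e (MonoidAlgebra.of F G g) i)
      map_one' := by
        rw [map_one, map_one, Pi.one_apply, Matrix.toLin'_one]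
        rfl
      map_mul' g h := by
        rw [map_mul, map_mul, Pi.mul_apply, Matrix.toLin'_mul]
        rfl }
  have hρ : ∀ i g, (ρ i).character g = (e (MonoidAlgebra.of F G g) i).trace := fun i g =>
    Matrix.trace_toLin'_eq _
  refine ⟨n, d, ρ, fun g h => ?_⟩
  simp only [hρ]
  rw [← trace_mulLeftRight_pi_matrix, ← trace_mulLeftRight_monoidAlgebra,
    ← LinearMap.trace_conj' _ e.toLinearEquiv]
  congr 1
  refine LinearMap.ext fun M => ?_
  rw [LinearEquiv.conj_apply_apply]
  change _ = e (_ * e.symm M * _)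
  rw [map_mul, map_mul, e.apply_symm_apply]
  rfl

end Orthogonality

/-! ### Separation of regular classes -/

section Separation

/-- The trace of a matrix with `M ^ (m + 1) = M` is integral, since the eigenvalues are zero or
roots of unity. -/
theorem isIntegral_trace_of_pow_succ_eq {F : Type*} [Field F] {n m : ℕ} (hm : m ≠ 0)
    (M : Matrix (Fin n) (Fin n) F) (hM : M ^ (m + 1) = M) : IsIntegral ℤ M.trace := by
  let L := AlgebraicClosure F
  let N := M.map (algebraMap F L)
  have hN : N ^ (m + 1) = N := by
    have := congrArg (fun A => (algebraMap F L).mapMatrix A) hM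
    rw [map_pow] at this
    exact this
  rw [← isIntegral_algebraMap_iff (algebraMap F L).injective]
  have h1 : algebraMap F L M.trace = N.trace := by simp [Matrix.trace, N]
  rw [h1, Matrix.trace_eq_sum_roots_charpoly]
  refine IsIntegral.multiset_sum fun μ hμ => ?_
  have hroot : N.charpoly.IsRoot μ := Polynomial.isRoot_of_mem_roots hμ
  rw [← Matrix.charpoly_toLin', ← Module.End.hasEigenvalue_iff_isRoot_charpoly] at hroot
  obtain ⟨v, hv⟩ := hroot.exists_hasEigenvector
  have h2 := hv.pow_apply (m + 1)
  rw [← Matrix.toLin'_pow, hN, hv.apply_eq_smul] at h2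
  have h3 : μ = μ ^ (m + 1) := smul_left_injective L hv.2 h2
  rcases eq_or_ne μ 0 with rfl | h0
  · exact isIntegral_zero
  · have h4 : μ ^ m = 1 := mul_right_cancel₀ h0 (by rw [← pow_succ, one_mul, ← h3])
    exact IsIntegral.of_pow (Nat.pos_of_ne_zero hm) (h4 ▸ isIntegral_one)

/-- If `x` centralizes the subgroup `Q`, then the average of a character over `x Q` is integral: it
is the trace of `x` on the `Q`-invariants. -/
theorem isIntegral_average_character {F G : Type*} [Field F] [CharZero F] [Group G] [Finite G]
    {d : ℕ} (ρ : Representation F G (Fin d → F)) (Q : Subgroup G) [Fintype Q] (x : G)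
    (hx : ∀ u ∈ Q, Commute x u) :
    IsIntegral ℤ ((Nat.card Q : F)⁻¹ * ∑ u : Q, ρ.character (x * u)) := by
  have hQ : (Nat.card Q : F) ≠ 0 := Nat.cast_ne_zero.2 Nat.card_pos.ne'
  -- the projection to the invariants of `Q`
  let e : Module.End F (Fin d → F) := (Nat.card Q : F)⁻¹ • ∑ u : Q, ρ u
  have he1 : ∀ v : Q, ρ v * e = e := by
    intro v
    rw [mul_smul_comm, Finset.mul_sum]
    congr 1
    exact Fintype.sum_equiv (Equiv.mulLeft v) _ _ fun u => by simp
  have he : e * e = e := by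
    conv_lhs => enter [1]; unfold e
    rw [smul_mul_assoc, Finset.sum_mul, Finset.sum_congr rfl fun v _ => he1 v, Finset.sum_const,
      Finset.card_univ, ← Nat.card_eq_fintype_card, ← Nat.cast_smul_eq_nsmul F, smul_smul,
      inv_mul_cancel₀ hQ, one_smul]
  have hc : Commute (ρ x) e :=
    (Commute.sum_right Finset.univ (fun u : Q => ρ u) _ fun u _ => (hx u u.2).map ρ).smul_right _
  have hpow : (ρ x * e) ^ (Nat.card G + 1) = ρ x * e := by
    rw [hc.mul_pow, pow_succ, ← map_pow, pow_card_eq_one', map_one, one_mul,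
      IsIdempotentElem.pow_succ_eq _ he]
  have htr : (Nat.card Q : F)⁻¹ * ∑ u : Q, ρ.character (x * u) =
      (LinearMap.toMatrix (Pi.basisFun F (Fin d)) (Pi.basisFun F (Fin d)) (ρ x * e)).trace := by
    rw [← LinearMap.trace_eq_matrix_trace F (Pi.basisFun F (Fin d))]
    simp [e, Finset.mul_sum, Representation.character]
  rw [htr]
  refine isIntegral_trace_of_pow_succ_eq (m := Nat.card G) Nat.card_pos.ne' _ ?_
  rw [LinearMap.toMatrix_pow, hpow]

/-- If `x` and `y` are `p`-regular and `u` is a `p`-element commuting with `x`, then `x * u` is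
conjugate to `y` only for `u = 1`. -/
theorem eq_one_of_conj_eq_mul {G : Type*} [Group G] {p : ℕ} (hp : p.Prime) {x y u h : G}
    (hx : ¬ p ∣ orderOf x) (hy : ¬ p ∣ orderOf y) (hxu : Commute x u)
    (hu : ∃ n, orderOf u = p ^ n) (hc : h * y * h⁻¹ = x * u) : u = 1 := by
  obtain ⟨n, hn⟩ := hu
  have h1 : (x * u) ^ orderOf y = 1 := by
    rw [← hc, conj_pow, pow_orderOf_eq_one, mul_one, mul_inv_cancel]
  have h2 : u ^ (orderOf x * orderOf y) = 1 := by
    have := congrArg (· ^ orderOf x) h1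
    simp only [← pow_mul, one_pow] at this
    rwa [hxu.mul_pow, mul_comm (orderOf y), pow_mul x, pow_orderOf_eq_one, one_pow, one_mul] at this
  have h3 := orderOf_dvd_of_pow_eq_one h2
  have h4 : Nat.Coprime (orderOf u) (orderOf x * orderOf y) := by
    rw [hn]
    exact Nat.Coprime.pow_left n ((Nat.Prime.coprime_iff_not_dvd hp).2
      fun h => (hp.dvd_mul.1 h).elim hx hy)
  exact orderOf_eq_one_iff.1 (Nat.Coprime.eq_one_of_dvd h4 h3)

variable {O K k : Type*} [CommRing O] [IsIntegrallyClosed O] [Field K] [CharZero K] [Algebra O K]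
  [IsFractionRing O K] [Field k] [Algebra O k] {G : Type*} [Group G] [Finite G]

/-- For each `p`-regular class there is an element of `k ⊗ R(KG)` at which the evaluation does not
vanish, while the evaluations at all other `p`-regular classes do. With `Q` a Sylow `p`-subgroup of
the centralizer of `x`, it is the reduction of the virtual character with coefficients
`tr(x⁻¹ | V_i^Q)`, whose value at `x` is the index of `Q` in the centralizer. -/
theorem exists_evBar_separating (hK : IsSplittingFieldFor K G) (p : ℕ) [hp : Fact p.Prime]
    [CharP k p] (x : G) (hx : ¬ p ∣ orderOf x) :
    ∃ ψ : ScalarGroth k K G, evBar K O k (ConjClasses.mk x) ψ ≠ 0 ∧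
      ∀ y, ¬ p ∣ orderOf y → ¬ IsConj y x → evBar K O k (ConjClasses.mk y) ψ = 0 := by
  classical
  cases nonempty_fintype G
  obtain ⟨n, d, ρ, hρ⟩ := IsSplittingFieldFor.exists_sum_character_mul hK
  let Z : Subgroup G := Subgroup.centralizer {x}
  let S : Sylow p Z := default
  let Q : Subgroup G := (S : Subgroup Z).map Z.subtype
  have hcard : Nat.card Q = Nat.card S :=
    Nat.card_congr ((S : Subgroup Z).equivMapOfInjective _ Z.subtype_injective).symm.toEquiv
  have hQx : ∀ u ∈ Q, Commute x u := by
    rintro _ ⟨u, -, rfl⟩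
    exact (Subgroup.mem_centralizer_singleton_iff.1 u.2).symm
  have hQp : ∀ u ∈ Q, ∃ n, orderOf u = p ^ n := by
    rintro _ ⟨u, hu, rfl⟩
    obtain ⟨n, hn⟩ := IsPGroup.iff_orderOf.1 S.isPGroup' ⟨u, hu⟩
    exact ⟨n, by simpa using hn⟩
  have hQ0 : (Nat.card Q : K) ≠ 0 := Nat.cast_ne_zero.2 Nat.card_pos.ne'
  have ha : ∀ i, ∃ a : O, algebraMap O K a =
      (Nat.card Q : K)⁻¹ * ∑ u : Q, (ρ i).character (x⁻¹ * u) := fun i =>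
    IsIntegrallyClosed.isIntegral_iff.1
      (isIntegral_average_character (ρ i) Q x⁻¹ fun u hu => (hQx u hu).inv_left).tower_top
  choose a ha using ha
  -- The values of `∑ a_i χ_i` at regular elements, by column orthogonality; they are multiplied by
  -- the order of `Q`, as that may fail to be invertible in `O`.
  have hval : ∀ y, ¬ p ∣ orderOf y →
      algebraMap O K (Nat.card Q * ∑ i, a i * ev O (ConjClasses.mk y) (cls (ρ i))) =
        ({h | h * y * h⁻¹ = x} : Finset G).card := by
    intro y hy
    have h1 : ∀ i, algebraMap O K (ev O (ConjClasses.mk y) (cls (ρ i))) = (ρ i).character y :=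
      fun i => (algebraMap_ev O _ _).trans (characterHom_cls y (ρ i))
    simp only [map_mul, map_sum, map_natCast, ha, h1]
    -- Only `u = 1` contributes, as `x * u⁻¹` is not conjugate to the regular element `y` otherwise.
    have h2 : ∀ u : Q, ∑ i, (ρ i).character (x⁻¹ * u) * (ρ i).character y =
        if u = 1 then (({h | h * y * h⁻¹ = x} : Finset G).card : K) else 0 := by
      intro u
      have h3 : ∀ h : G, x⁻¹ * u * h * y = h ↔ h * y * h⁻¹ = x * (u : G)⁻¹ := by
        intro h
        rw [(hQx u u.2).inv_right.eq, mul_inv_eq_iff_eq_mul, mul_assoc, mul_assoc, mul_assoc,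
          inv_mul_eq_iff_eq_mul, ← eq_inv_mul_iff_mul_eq]
      rw [hρ]
      simp only [h3]
      split_ifs with hu
      · simp [hu]
      · rw [Nat.cast_eq_zero, Finset.card_eq_zero, Finset.filter_eq_empty_iff]
        intro h _ hh
        obtain ⟨n, hn⟩ := hQp _ (inv_mem u.2)
        have := eq_one_of_conj_eq_mul hp.out hx hy (hQx u u.2).inv_right ⟨n, hn⟩ hh
        exact hu (Subtype.ext (inv_eq_one.1 this))
    calc (Nat.card Q : K) * ∑ i, (Nat.card Q : K)⁻¹ * (∑ u : Q, (ρ i).character (x⁻¹ * u)) *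
          (ρ i).character y
        = ∑ u : Q, ∑ i, (ρ i).character (x⁻¹ * u) * (ρ i).character y := by
          rw [Finset.sum_comm, Finset.mul_sum]
          refine Finset.sum_congr rfl fun i _ => ?_
          rw [← mul_assoc, mul_inv_cancel_left₀ hQ0, Finset.sum_mul]
      _ = _ := by simp [h2]
  have hinj := IsFractionRing.injective O K
  let ψ (i : Fin n) : ScalarGroth k K G :=
    (algebraMap O k (a i) ⊗ₜ[ℤ] cls (ρ i) : k ⊗[ℤ] Groth K G)
  have hev : ∀ y, evBar K O k (ConjClasses.mk y) (∑ i, ψ i) =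
      algebraMap O k (∑ i, a i * ev O (ConjClasses.mk y) (cls (ρ i))) := by
    intro y
    rw [map_sum, map_sum]
    exact Finset.sum_congr rfl fun i _ =>
      (evBar_tmul O k (ConjClasses.mk y) _ _).trans (map_mul _ _ _).symm
  refine ⟨∑ i, ψ i, ?_, fun y hy hyx => ?_⟩
  · have hZ : ({h | h * x * h⁻¹ = x} : Finset G).card = Nat.card Z := by
      refine (Nat.subtype_card _ fun h => ?_).symm
      rw [Finset.mem_filter_univ, mul_inv_eq_iff_eq_mul]
      exact Subgroup.mem_centralizer_singleton_iff.symm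
    have h4 : ∑ i, a i * ev O (ConjClasses.mk x) (cls (ρ i)) = ((S : Subgroup Z).index : O) := by
      have h5 := hval x hx
      rw [hZ, ← (S : Subgroup Z).card_mul_index, ← hcard, map_mul, map_natCast, Nat.cast_mul] at h5
      exact hinj ((mul_left_cancel₀ hQ0 h5).trans (map_natCast _ _).symm)
    rw [hev, h4, map_natCast, Ne, CharP.cast_eq_zero_iff k p]
    exact S.not_dvd_index
  · have h4 : ({h | h * y * h⁻¹ = x} : Finset G) = ∅ := by
      rw [Finset.filter_eq_empty_iff]
      exact fun h _ hh => hyx (isConj_iff.2 ⟨h, hh⟩)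
    have h5 := hval y hy
    rw [h4, Finset.card_empty, Nat.cast_zero, map_mul, map_natCast] at h5
    rw [hev, (map_eq_zero_iff _ hinj).1 ((mul_eq_zero.1 h5).resolve_left hQ0), map_zero]

end Separation

/-! ### Joint kernel of the evaluations on `k ⊗ R(kG)` -/

section CharBar

variable {k : Type*} [Field k] {p : ℕ} [Fact p.Prime] {G : Type*} [Group G]

theorem charBar_mul_eq [CharP k p] {u s : G} (h : Commute u s) {n : ℕ} (hu : u ^ p ^ n = 1) :
    charBar k (u * s) = charBar k s := by
  simp only [charBar, characterHom_mul_eq (F := k) h hu]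
  rfl

/-- Over a splitting field `k`, an element of `k ⊗ R(kG)` is determined by its evaluations. -/
theorem eq_zero_of_forall_charBar_eq_zero (hk : IsSplittingFieldFor k G) (z : ScalarGroth k k G)
    (hz : ∀ g, charBar k g z = 0) : z = 0 :=
  eq_zero_of_forall_eval_eq_zero hk (RingHom.id k) Function.injective_id
    (fun g => (charBar k g : ScalarGroth k k G →+ k)) (fun g a x => charBar_tmul g a x) z hz

end CharBar

/-! ### Algebras detected up to nilpotents by homomorphisms to the base field -/

section Detected

variable {k R : Type*} [Field k] [CommRing R] [Algebra k R]

theorem ker_isMaximal (φ : R →ₐ[k] k) : (RingHom.ker φ).IsMaximal :=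
  RingHom.ker_isMaximal_of_surjective φ fun c => ⟨algebraMap k R c, by simp⟩

/-- The simple module attached to `φ` is the quotient by the kernel of `φ`. -/
theorem CharModule.exists_quotient_equiv (φ : R →ₐ[k] k) :
    Nonempty ((R ⧸ RingHom.ker φ) ≃ₗ[R] CharModule φ) := by
  let f : R →ₗ[R] CharModule φ :=
    { toFun := φ
      map_add' := map_add φ
      map_smul' := map_mul φ }
  have hf : Function.Surjective f := fun c => ⟨algebraMap k R c, φ.commutes c⟩
  exact ⟨f.quotKerEquivOfSurjective hf⟩

theorem CharModule.isSimpleModule (φ : R →ₐ[k] k) : IsSimpleModule R (CharModule φ) :=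
  isSimpleModule_iff_quot_maximal.2
    ⟨RingHom.ker φ, ker_isMaximal φ, ⟨(exists_quotient_equiv φ).some.symm⟩⟩

theorem CharModule.smul_eq (φ : R →ₐ[k] k) (a : R) (x : CharModule φ) :
    a • x = algebraMap k R (φ a) • x := by
  change Mul.mul (α := k) (φ a) x = Mul.mul (α := k) (φ (algebraMap k R (φ a))) x
  rw [AlgHom.commutes]
  rfl

theorem CharModule.eq_of_equiv {φ ψ : R →ₐ[k] k} (e : CharModule φ ≃ₗ[R] CharModule ψ) :
    φ = ψ := by
  have := (CharModule.isSimpleModule φ).nontrivial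
  obtain ⟨x, hx⟩ := exists_ne (0 : CharModule φ)
  ext a
  have h1 := congrArg e (CharModule.smul_eq φ a x)
  rw [map_smul, map_smul] at h1
  let y : k := e x
  have hy : y ≠ 0 := fun h => hx (e.map_eq_zero_iff.1 h)
  have h2 : ψ a * y = ψ (algebraMap k R (φ a)) * y := h1
  rw [AlgHom.commutes] at h2
  exact (mul_right_cancel₀ hy h2).symm

variable {ι : Type*} [Finite ι] {Φ : ι → R →ₐ[k] k}

/-- If finitely many homomorphisms to `k` detect elements up to nilpotents, then their kernels are
the only maximal ideals, so that every simple module is attached to one of them. -/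
theorem exists_equiv_charModule (hΦ : ∀ z, (∀ i, Φ i z = 0) → IsNilpotent z) (M : Type*)
    [AddCommGroup M] [Module R M] [IsSimpleModule R M] :
    ∃ i, Nonempty (M ≃ₗ[R] CharModule (Φ i)) := by
  cases nonempty_fintype ι
  obtain ⟨m, hm, ⟨e⟩⟩ := isSimpleModule_iff_quot_maximal.1 ‹IsSimpleModule R M›
  have hle : Finset.univ.inf (fun i => RingHom.ker (Φ i)) ≤ m := by
    intro z hz
    obtain ⟨n, hn⟩ := hΦ z fun i =>
      Finset.inf_le (f := fun i => RingHom.ker (Φ i)) (Finset.mem_univ i) hz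
    exact hm.isPrime.mem_of_pow_mem n (hn ▸ zero_mem m)
  obtain ⟨i, -, hi⟩ := (hm.isPrime.inf_le').1 hle
  obtain rfl := (ker_isMaximal (Φ i)).eq_of_le hm.ne_top hi
  exact ⟨i, ⟨e.trans (CharModule.exists_quotient_equiv (Φ i)).some⟩⟩

omit [Finite ι] in
theorem mem_jacobson_iff_forall_eq_zero (hΦ : ∀ z, (∀ i, Φ i z = 0) → IsNilpotent z) (z : R) :
    z ∈ Ring.jacobson R ↔ ∀ i, Φ i z = 0 := by
  rw [Ring.jacobson_eq_sInf_isMaximal, Submodule.mem_sInf]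
  refine ⟨fun h i => h _ (ker_isMaximal (Φ i)), fun h m hm => ?_⟩
  obtain ⟨n, hn⟩ := hΦ z h
  exact Ideal.IsPrime.mem_of_pow_mem (Ideal.IsMaximal.isPrime hm) n (hn ▸ zero_mem m)

theorem isSplit_of_forall_isNilpotent (hΦ : ∀ z, (∀ i, Φ i z = 0) → IsNilpotent z) :
    IsSplit k R := by
  intro S _ _ _ f
  obtain ⟨i, ⟨e⟩⟩ := exists_equiv_charModule hΦ S
  have := IsSimpleModule.nontrivial R S
  obtain ⟨s, hs⟩ := exists_ne (0 : S)
  have hsmul : ∀ (a : R) (x : S), a • x = algebraMap k R (Φ i a) • x := fun a x =>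
    e.injective (by rw [map_smul, map_smul, CharModule.smul_eq])
  obtain ⟨r, hr⟩ := IsSimpleModule.toSpanSingleton_surjective R hs (f s)
  refine ⟨Φ i r, fun x => ?_⟩
  obtain ⟨t, rfl⟩ := IsSimpleModule.toSpanSingleton_surjective R hs x
  rw [LinearMap.toSpanSingleton_apply] at hr ⊢
  rw [map_smul, ← hr, ← hsmul, smul_comm]

theorem irr_eq (hΦ : ∀ z, (∀ i, Φ i z = 0) → IsNilpotent z) :
    irr k R = {φ | ∃ i, φ = (Φ i).toLinearMap} := by
  -- On a module isomorphic to the one attached to `Φ i`, which has dimension one, the element `a`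
  -- acts as the scalar `Φ i a`.
  have key : ∀ i (S : Type _) [AddCommGroup S] [Module k S] [Module R S] [IsScalarTower k R S],
      Nonempty (S ≃ₗ[R] CharModule (Φ i)) →
      FiniteDimensional k S ∧ ∀ a, LinearMap.trace k S (Algebra.lsmul k k S a) = Φ i a := by
    intro i S _ _ _ _ ⟨e⟩
    let e' : S ≃ₗ[k] k :=
      { toFun := e
        map_add' := map_add e
        map_smul' := fun c x => by
          have h := e.map_smul (algebraMap k R c) x
          rw [algebraMap_smul] at h
          refine h.trans ?_
          change Φ i (algebraMap k R c) * _ = c * _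
          rw [AlgHom.commutes]
          rfl
        invFun := e.symm
        left_inv := e.left_inv
        right_inv := e.right_inv }
    have : FiniteDimensional k S := Module.Finite.equiv e'.symm
    refine ⟨this, fun a => ?_⟩
    have h : Algebra.lsmul k k S a = Φ i a • LinearMap.id := LinearMap.ext fun x =>
      e.injective <| by
        change e (a • x) = e (Φ i a • x)
        rw [← algebraMap_smul R (Φ i a) x, map_smul, map_smul, CharModule.smul_eq]
    rw [h, map_smul, LinearMap.trace_id, e'.finrank_eq, Module.finrank_self]
    simp
  ext φ
  constructor
  · rintro ⟨S, _, _, _, _, hS, -, hφ⟩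
    obtain ⟨i, hi⟩ := exists_equiv_charModule hΦ S
    exact ⟨i, LinearMap.ext fun a => (hφ a).trans ((key i S hi).2 a)⟩
  · rintro ⟨i, rfl⟩
    have hi := CharModule.exists_quotient_equiv (Φ i)
    refine ⟨R ⧸ RingHom.ker (Φ i), inferInstance, inferInstance, inferInstance, inferInstance, ?_,
      (key i _ hi).1, fun a => ((key i _ hi).2 a).symm⟩
    exact isSimpleModule_iff_quot_maximal.2 ⟨_, ker_isMaximal (Φ i), ⟨.refl R _⟩⟩

end Detected

end CharacterRing

open CharacterRing in
theorem corollary2p6 {O : Type*} [CommRing O] [IsDedekindDomain O] [CharZero O]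
    (P : Ideal O) [P.IsMaximal] (p : ℕ) [Fact p.Prime] [CharP P.ResidueField p]
    (K : Type*) [Field K] [Algebra O K] [IsFractionRing O K]
    [Algebra (Localization.AtPrime P) K] [IsScalarTower O (Localization.AtPrime P) K]
    (G : Type*) [Group G] [Finite G]
    (hK : CharacterRing.IsSplittingFieldFor K G)
    (hk : CharacterRing.IsSplittingFieldFor P.ResidueField G) :
    -- (a) the modules `D_C`, for `C` a `p`-regular class, represent the simple modules
    ((∀ C : ConjClasses G, CharacterRing.IsPRegular p C →
        IsSimpleModule (CharacterRing.ScalarGroth P.ResidueField K G)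
          (CharacterRing.CharModule (CharacterRing.evBar K O P.ResidueField C))) ∧
      (∀ C C' : ConjClasses G,
        CharacterRing.IsPRegular p C → CharacterRing.IsPRegular p C' →
        Nonempty (CharacterRing.CharModule (CharacterRing.evBar K O P.ResidueField C)
          ≃ₗ[CharacterRing.ScalarGroth P.ResidueField K G]
            CharacterRing.CharModule (CharacterRing.evBar K O P.ResidueField C')) →
        C = C') ∧
      (∀ (M : Type*) [AddCommGroup M] [Module (CharacterRing.ScalarGroth P.ResidueField K G) M]
        [IsSimpleModule (CharacterRing.ScalarGroth P.ResidueField K G) M],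
        ∃ C : ConjClasses G, CharacterRing.IsPRegular p C ∧
          Nonempty (M ≃ₗ[CharacterRing.ScalarGroth P.ResidueField K G]
            CharacterRing.CharModule (CharacterRing.evBar K O P.ResidueField C)))) ∧
    -- (b) the irreducible characters
    CharacterRing.irr P.ResidueField (CharacterRing.ScalarGroth P.ResidueField K G) =
      {φ | ∃ C : ConjClasses G, CharacterRing.IsPRegular p C ∧
        φ = (CharacterRing.evBar K O P.ResidueField C).toLinearMap} ∧
    -- (c) the radical is the kernel of the decomposition map
    (Ring.jacobson (CharacterRing.ScalarGroth P.ResidueField K G)).restrictScalars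
        P.ResidueField =
      LinearMap.ker (CharacterRing.scalarMap P.ResidueField
        (CharacterRing.decompositionMapAt P K G)) ∧
    -- (d) the algebra is split
    CharacterRing.IsSplit P.ResidueField (CharacterRing.ScalarGroth P.ResidueField K G) := by
  have : CharZero K := charZero_of_injective_algebraMap (IsFractionRing.injective O K)
  have hsurj : Function.Surjective (algebraMap O P.ResidueField) :=
    P.algebraMap_residueField_surjective
  have hd : ∀ g z, evBar K O P.ResidueField (ConjClasses.mk g) z =
      charBar P.ResidueField g (scalarMap P.ResidueField (decompositionMapAt P K G) z) :=
    fun g z => evBar_mk_eq (decompositionMapAt P K G) g (algebraMap_ev_eq_characterHom P K g) z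
  -- The kernel of `d` is detected by the regular classes: the evaluation at `g` factors through `d`
  -- and only depends on the regular part of `g`.
  have hker : ∀ z : ScalarGroth P.ResidueField K G,
      (∀ C : {C : ConjClasses G // IsPRegular p C}, evBar K O P.ResidueField C.1 z = 0) ↔
        scalarMap P.ResidueField (decompositionMapAt P K G) z = 0 := by
    refine fun z => ⟨fun h => ?_, fun h C => ?_⟩
    · refine eq_zero_of_forall_charBar_eq_zero hk _ fun g => ?_
      obtain ⟨u, s, rfl, hus, ⟨n, hn⟩, hs⟩ := exists_regular_part p g
      rw [charBar_mul_eq hus hn, ← hd]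
      exact h ⟨ConjClasses.mk s, isPRegular_mk.2 hs⟩
    · obtain ⟨g, hg⟩ := ConjClasses.exists_rep C.1
      rw [← hg, hd, h, map_zero]
  have hnil : ∀ z : ScalarGroth P.ResidueField K G,
      (∀ C : {C : ConjClasses G // IsPRegular p C}, evBar K O P.ResidueField C.1 z = 0) →
        IsNilpotent z := by
    refine fun z hz => isNilpotent_of_forall_evBar_eq_zero hK hsurj z fun C => ?_
    obtain ⟨g, rfl⟩ := ConjClasses.exists_rep C
    rw [hd, (hker z).1 hz, map_zero]
  refine ⟨⟨fun C _ => CharModule.isSimpleModule _, fun C C' hC hC' ⟨e⟩ => ?_, fun M _ _ _ => ?_⟩,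
    ?_, ?_, isSplit_of_forall_isNilpotent hnil⟩
  · have he := CharModule.eq_of_equiv e
    obtain ⟨x, rfl⟩ := ConjClasses.exists_rep C
    obtain ⟨y, rfl⟩ := ConjClasses.exists_rep C'
    obtain ⟨ψ, hψ, hψ'⟩ := exists_evBar_separating (O := O) (k := P.ResidueField) hK p x
      (isPRegular_mk.1 hC)
    by_contra hne
    refine hψ ?_
    rw [he]
    exact hψ' y (isPRegular_mk.1 hC') fun h => hne (ConjClasses.mk_eq_mk_iff_isConj.2 h.symm)
  · obtain ⟨C, hC⟩ := exists_equiv_charModule hnil M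
    exact ⟨C.1, C.2, hC⟩
  · rw [irr_eq hnil]
    ext φ
    exact ⟨fun ⟨C, hC⟩ => ⟨C.1, C.2, hC⟩, fun ⟨C, h, hC⟩ => ⟨⟨C, h⟩, hC⟩⟩
  · ext z
    exact (mem_jacobson_iff_forall_eq_zero hnil z).trans (hker z)
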